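/- Let $d\in\mathbb N$ and let $\{X_{nj}: n\in\mathbb N,\ j\in\mathbb Z^d\}$ be real random variables on a probability space $(\Omega,\mathcal F,P)$ such that, for each $n$, the variables $X_{nj}$, $j\in\mathbb Z^d$, are independent and have mean zero. Suppose that for each $n$ there is $H_n>0$ such that for every $j$ the cumulant generating function $L_{nj}(z)=\log \mathbb E e^{zX_{nj}}$ (with $L_{nj}(0)=0$) exists and is analytic in the disc $\{z\in\mathbb C:|z|<H_n\}$. The cumulant of order $k$ of $X_{nj}$ is $\gamma_{knj}=L_{nj}^{(k)}(0)$; in particular $\gamma_{2nj}=\sigma_{nj}^2=\mathbb E X_{nj}^2$. Let $B_n=\sum_{j\in\mathbb Z^d}\sigma_{nj}^2$, assume $B_n<\infty$, let $S_n=\sum_{j\in\mathbb Z^d}X_{nj}$ be the limit in probability, as $m\to\infty$, of the sums over $[-m,m]^d\cap\mathbb Z^d$, and put $F_n(x)=P(S_n<x\sqrt{B_n})$. Let $\Phi$ be the standard normal distribution function. Suppose that there are non-negative constants $c_{nj}$ with $|L_{nj}(z)|\le c_{nj}$ for all $|z|<H_n$, that $B_nH_n^2\to\infty$ as $n\to\infty$,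 that $\sum_{j}c_{nj}<\infty$ for every $n$, and that $\sum_{j\in\mathbb Z^d}c_{nj}=O(B_nH_n^2)$. Then there are power series $\lambda_n(t)=\sum_{k\ge 0}\beta_{kn}t^k$ with real coefficients, where $\beta_{kn}$ depends only on $k$, $d$, $H_n$ and the cumulants of the variables $X_{nj}$, $j\in\mathbb Z^d$ (that is, $\beta_{kn}$ is the value at $H_n$ and $(\gamma_{\ell nj})_{\ell\ge0,\,j\in\mathbb Z^d}$ of a function that is the same for all such random fields), with the following properties. (i) There are $\rho>0$ and $K$ such that for all $n$ and all complex $t$ with $|t|<\rho$ the series $\lambda_n(t)$ converges and $|\lambda_n(t)|\le K$. (ii) If $x\ge 0$ and $x=o(H_n\sqrt{B_n})$, then $$\frac{1-F_n(x)}{1-\Phi(x)}=\exp\Big\{\frac{x^3}{H_n\sqrt{B_n}}\,\lambda_n\Big(\frac{x}{H_n\sqrt{B_n}}\Big)\Big\}\Big(1+O\Big(\frac{x+1}{H_n\sqrt{B_n}}\Big)\Big),$$ $$\frac{F_n(-x)}{\Phi(-x)}=\exp\Big\{-\frac{x^3}{H_n\sqrt{B_n}}\,\lambda_n\Big(-\frac{x}{H_n\sqrt{B_n}}\Big)\Big\}\Big(1+O\Big(\frac{x+1}{H_n\sqrt{B_n}}\Big)\Big).$$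 This holds uniformly in $x$: there is a constant $C$ such that for every real sequence $a_n=o(H_n\sqrt{B_n})$ there is $N$ such that for all $n\ge N$ and all $0\le x\le a_n$ both $O$-terms are at most $C\,\frac{x+1}{H_n\sqrt{B_n}}$ in absolute value. -/

import Mathlib

open MeasureTheory ProbabilityTheory Filter Topology Asymptotics

noncomputable section

/-- `L` is the cumulant generating function `z ↦ log E exp (z X)` of the real random variable `X`
on the complex disc `|z| < H`: the exponential moments exist there, and `L` is the analytic
logarithm of `z ↦ E exp (z X)` with `L 0 = 0`. These properties determine `L` on the disc, and if
the principal value of `log E exp (z X)` is analytic on the disc, it is this function. -/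
structure IsCGFOnDisc {Ω : Type*} [MeasurableSpace Ω] (P : Measure Ω) (X : Ω → ℝ) (H : ℝ)
    (L : ℂ → ℂ) : Prop where
  integrable_cexp : ∀ z : ℂ, ‖z‖ < H → Integrable (fun ω => Complex.exp (z * X ω)) P
  analytic : AnalyticOnNhd ℂ L (Metric.ball 0 H)
  exp_eq : ∀ z : ℂ, ‖z‖ < H → Complex.exp (L z) = complexMGF X P z
  map_zero : L 0 = 0

/-- The cumulant of order `k` of `X`: the `k`-th derivative at `0` of `t ↦ log E exp (t X)`. -/
def cumulant {Ω : Type*} [MeasurableSpace Ω] (P : Measure Ω) (X : Ω → ℝ) (k : ℕ) : ℝ :=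
  iteratedDeriv k (cgf X P) 0

/-- The lattice cube `[-m, m]^d ∩ ℤ^d`. -/
def latticeCube (d m : ℕ) : Finset (Fin d → ℤ) :=
  Finset.Icc (fun _ => -(m : ℤ)) (fun _ => (m : ℤ))

/-- The sum of the variances of a family of random variables. -/
def varSum {Ω ι : Type*} [MeasurableSpace Ω] (P : Measure Ω) (X : ι → Ω → ℝ) : ℝ :=
  ∑' j, variance (X j) P

/-- `P (S < x √B)`, the (left-continuous) distribution function of `S / √B`. -/
def normalizedDF {Ω : Type*} [MeasurableSpace Ω] (P : Measure Ω) (S : Ω → ℝ) (B x : ℝ) : ℝ :=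
  P.real {ω | S ω < x * √B}

/-- The standard normal distribution function `Φ`. -/
def stdNormalDF (x : ℝ) : ℝ :=
  cdf (gaussianReal 0 1) x

/-- The value at a real point of the power series with coefficients `b`. -/
def seriesValue (b : ℕ → ℝ) (t : ℝ) : ℝ :=
  ∑' k, b k * t ^ k

end

/-! The proof is Cramér's method with every constant depending only on a number `A` for which `∑ c_j
≤ A B H²`. Cauchy's estimates bound `|γ_k / k!| H^k` by `c_j` for each variable. Summing over `j`,
the law of `H S` has cumulant generating function `T² g` on the unit disc, where `T = H √B` and
`g(z) = z²/2 + ⋯` has all its coefficients bounded by `A` (`normalizedCoeffs_normalizedCumulants`,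
`hasScaledCGF_map`). The rest is uniform over such `g`.

For `x = T t`, let `u` solve `g'(u) = t` (`NormalizedCoeffs.exists_saddle`). Tilting the law by
`e^{uy}` moves its mean to `T² t = x T`, the endpoint of the tail. The tilted law, normalized with
`σ = T √(g''(u))`, is within `O(1/T)` of the normal law on all intervals
(`exists_kolmogorov_tiltedLaw`, from the smoothing inequality `exists_smoothing_const`). The tail
equals `exp (T² (g(u) - t u))` times the integral of `e^{-uσz}` over the half-line `z ≥ 0` (or `z >
0`) under the tilted law. Passing to the normal law, and then from `uσ` to `x`, costs `O(1/T)`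
(`abs_setIntegral_exp_sub_le`, `abs_gaussianLaplace_sub_le`).

Since `1 - Φ(x) = e^{-x²/2} ψ(x)` with `ψ(x) ≥ c / (1 + x)`, the quotient is `exp (T² (t²/2 + g(u) -
t u))` with relative error `O((x + 1)/T)` (`exists_tail_ratio`). The bracket is analytic in `t` and
vanishes to third order, so it is `t³ λ(t)`, with bounds on `λ` from Cauchy's estimates
(`exists_cramerSeries`); and `T² t³ = x³/T`. The lower tail follows by reflection. -/

noncomputable section

/-! ### Fourier smoothing: from characteristic functions to intervals -/

open scoped SchwartzMap FourierTransform in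
/-- A band-limited kernel of integral one with quadratically small tails. -/
theorem exists_bandlimited_kernel : ∃ (b K : ℝ → ℂ) (C : ℝ), 0 ≤ C ∧ Continuous b ∧
    (∀ u, ‖b u‖ ≤ 1) ∧ (∀ u, 1 < 2 * Real.pi * |u| → b u = 0) ∧ Integrable b ∧
    (∀ v, K v = ∫ u, Complex.exp ((2 * Real.pi * u * v : ℝ) * Complex.I) * b u) ∧
    Integrable K ∧ ∫ v, K v = 1 ∧
    (∀ s, 0 ≤ s → ∫ v in Set.Ioi s, ‖K v‖ ≤ C / (Real.pi + s) ^ 2) ∧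
    (∀ s, 0 ≤ s → ∫ v in Set.Iic (-s), ‖K v‖ ≤ C / (Real.pi + s) ^ 2) := by
  have hpi := Real.pi_pos
  -- The outer radius `1 / (2π)` makes `2π|u| ≤ 1` on the support, so after rescaling by `U` only
  -- frequencies in `[-U, U]` occur. The value `1` at the origin becomes the integral of `K`.
  let β : ContDiffBump (0 : ℝ) := ⟨1 / (4 * Real.pi), 1 / (2 * Real.pi), by positivity, by
    rw [div_lt_div_iff_of_pos_left] <;> first | positivity | linarith⟩
  have hβ : ContDiff ℝ (⊤ : ℕ∞) (fun u => (β u : ℂ)) :=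
    Complex.ofRealCLM.contDiff.comp β.contDiff
  have hβc : HasCompactSupport (fun u => (β u : ℂ)) :=
    β.hasCompactSupport.comp_left (g := fun x : ℝ => (x : ℂ)) (by simp)
  let b : 𝓢(ℝ, ℂ) := hβc.toSchwartzMap hβ
  have hb : ∀ u, b u = (β u : ℂ) := fun u => rfl
  let K : 𝓢(ℝ, ℂ) := 𝓕⁻ b
  have hint : Integrable (fun v => (Real.pi + |v|) ^ 2 * ‖K v‖) := by
    have h0 := (K.integrable (μ := volume)).norm.const_mul (Real.pi ^ 2)
    have h1 := (K.integrable_pow_mul volume 1).const_mul (2 * Real.pi)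
    have h2 := K.integrable_pow_mul volume 2
    refine ((h0.add h1).add h2).congr (ae_of_all _ fun v => ?_)
    simp only [Pi.add_apply, Real.norm_eq_abs]
    ring
  -- Markov's inequality with the weight `(π + |v|)²`, chosen to match the lower bound for the Fejér
  -- kernels.
  have key : ∀ s, 0 ≤ s → ∀ A : Set ℝ, MeasurableSet A → (∀ v ∈ A, s ≤ |v|) →
      ∫ v in A, ‖K v‖ ≤ (∫ v, (Real.pi + |v|) ^ 2 * ‖K v‖) / (Real.pi + s) ^ 2 := by
    intro s hs A hA hAs
    rw [le_div_iff₀ (by positivity), ← integral_mul_const]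
    refine (setIntegral_mono_on ?_ hint.integrableOn hA ?_).trans
      (setIntegral_le_integral hint (ae_of_all _ fun v => by positivity))
    · exact ((K.integrable (μ := volume)).norm.mul_const _).integrableOn
    · intro v hv
      rw [mul_comm]
      have := hAs v hv
      gcongr
  refine ⟨b, K, ∫ v, (Real.pi + |v|) ^ 2 * ‖K v‖, integral_nonneg fun v => by positivity,
    b.continuous, fun u => ?_, fun u hu => ?_, b.integrable, fun v => ?_, K.integrable, ?_,
    fun s hs => key s hs _ measurableSet_Ioi fun v hv => ?_,
    fun s hs => key s hs _ measurableSet_Iic fun v hv => ?_⟩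
  · rw [hb, Complex.norm_real, Real.norm_of_nonneg β.nonneg]
    exact β.le_one
  · rw [hb, β.zero_of_le_dist, Complex.ofReal_zero]
    simp only [dist_zero_right, Real.norm_eq_abs, β]
    rw [div_le_iff₀ (by positivity)]
    linarith
  · simp only [K, SchwartzMap.fourierInv_coe, Real.fourierInv_eq', smul_eq_mul]
    congr 1
    ext u
    congr 4
    simp; ring
  · have h : (𝓕 K : 𝓢(ℝ, ℂ)) = b := FourierTransform.fourier_fourierInv_eq b
    replace h := congrArg (fun f : 𝓢(ℝ, ℂ) => f 0) h
    simp only [SchwartzMap.fourier_coe, Real.fourier_real_eq] at h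
    simp only [mul_zero, neg_zero, AddChar.map_zero_eq_one, one_smul] at h
    rw [h, hb, β.one_of_mem_closedBall (by simp [β.rIn_pos.le]), Complex.ofReal_one]
  · exact (le_of_lt hv).trans (le_abs_self v)
  · exact (le_neg_of_le_neg hv).trans (neg_le_abs v)

/-- The Fejér kernel and its translate by `π` have no common zero. -/
theorem four_div_sq_le_fejer (y : ℝ) :
    4 / (Real.pi + |y|) ^ 2 ≤ ‖∫ u in (0 : ℝ)..1, Complex.exp (Complex.I * y * u)‖ ^ 2 +
      ‖∫ u in (0 : ℝ)..1, Complex.exp (Complex.I * (y + Real.pi : ℝ) * u)‖ ^ 2 := by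
  have hpi := Real.pi_pos
  have key : ∀ y : ℝ, (2 - 2 * Real.cos y) =
      ‖∫ u in (0 : ℝ)..1, Complex.exp (Complex.I * y * u)‖ ^ 2 * y ^ 2 := by
    intro y
    rcases eq_or_ne y 0 with rfl | hy
    · simp
    · rw [integral_exp_mul_complex (mul_ne_zero Complex.I_ne_zero (by exact_mod_cast hy)),
        norm_div, div_pow, norm_mul, Complex.norm_I, one_mul, Complex.norm_real, Real.norm_eq_abs,
        sq_abs, div_mul_cancel₀ _ (by positivity), ← Complex.normSq_eq_norm_sq,
        Complex.normSq_apply]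
      simp only [Complex.ofReal_one, mul_one, Complex.ofReal_zero, mul_zero, Complex.exp_zero,
        Complex.sub_re, Complex.sub_im, Complex.one_re, Complex.one_im, mul_comm Complex.I,
        Complex.exp_ofReal_mul_I_re, Complex.exp_ofReal_mul_I_im]
      nlinarith [Real.sin_sq_add_cos_sq y]
  -- As `cos (y + π) = -cos y`, the two identities add up to `4`, and both weights `y²` and `(y +
  -- π)²` are at most `(π + |y|)²`.
  have h1 := key y
  have h2 := key (y + Real.pi)
  rw [Real.cos_add_pi] at h2
  set a := ‖∫ u in (0 : ℝ)..1, Complex.exp (Complex.I * y * u)‖ ^ 2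
  set c := ‖∫ u in (0 : ℝ)..1, Complex.exp (Complex.I * (y + Real.pi : ℝ) * u)‖ ^ 2
  have ha : 0 ≤ a := by positivity
  have hc : 0 ≤ c := by positivity
  rw [div_le_iff₀ (by positivity)]
  have h3 : y ^ 2 ≤ (Real.pi + |y|) ^ 2 := by
    rw [← sq_abs y]; gcongr; linarith
  have h4 : (y + Real.pi) ^ 2 ≤ (Real.pi + |y|) ^ 2 := by
    rw [← sq_abs (y + Real.pi)]; gcongr
    calc |y + Real.pi| ≤ |y| + |Real.pi| := abs_add_le _ _
      _ = Real.pi + |y| := by rw [abs_of_pos hpi, add_comm]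
  nlinarith [mul_le_mul_of_nonneg_left h3 ha, mul_le_mul_of_nonneg_left h4 hc]

theorem integrable_fejer (μ : Measure ℝ) [IsFiniteMeasure μ] (U α : ℝ) :
    Integrable (fun y : ℝ =>
      ‖∫ u in (0 : ℝ)..1, Complex.exp (Complex.I * (U * (y - α) : ℝ) * u)‖ ^ 2) μ := by
  refine Integrable.of_bound (Continuous.aestronglyMeasurable ?_) 1 (ae_of_all _ fun y => ?_)
  · refine (Continuous.norm ?_).pow 2
    refine intervalIntegral.continuous_parametric_intervalIntegral_of_continuous' ?_ _ _
    fun_prop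
  · rw [Real.norm_of_nonneg (by positivity)]
    have : ‖∫ u in (0 : ℝ)..1, Complex.exp (Complex.I * (U * (y - α) : ℝ) * u)‖ ≤ 1 * |(1:ℝ) - 0| :=
      intervalIntegral.norm_integral_le_of_norm_le_const fun u _ => by
        rw [mul_assoc, ← Complex.ofReal_mul, mul_comm, Complex.norm_exp_ofReal_mul_I]
    simp only [sub_zero, abs_one, mul_one] at this
    exact pow_le_one₀ (norm_nonneg _) this

/-- The squared modulus is a double integral of `e^{iU(p₁-p₂)(y-α)}` over the unit square.
Integrating in `y` first leaves the characteristic function at `U(p₁-p₂)`, which lies in `[-U, U]`;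
its Gaussian bound, integrated over a whole line in `p₂`, gives `2√π / U`. -/
theorem integral_fejer_le {μ : Measure ℝ} [IsProbabilityMeasure μ] {U : ℝ} (hU : 0 < U)
    (hμ : ∀ t : ℝ, |t| ≤ U → ‖charFun μ t‖ ≤ Real.exp (-t ^ 2 / 4)) (α : ℝ) :
    ∫ y, ‖∫ u in (0 : ℝ)..1, Complex.exp (Complex.I * (U * (y - α) : ℝ) * u)‖ ^ 2 ∂μ ≤
      2 * √Real.pi / U := by
  set ν : Measure ℝ := volume.restrict (Set.Ioc 0 1) with hν
  have hexp : ∀ y : ℝ,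
      ((‖∫ u in (0 : ℝ)..1, Complex.exp (Complex.I * (U * (y - α) : ℝ) * u)‖ ^ 2 : ℝ) : ℂ) =
      ∫ p : ℝ × ℝ, Complex.exp ((U * (p.1 - p.2) * (y - α) : ℝ) * Complex.I) ∂(ν.prod ν) := by
    intro y
    rw [Complex.ofReal_pow, ← Complex.mul_conj', intervalIntegral.integral_of_le zero_le_one,
      ← integral_conj, ← integral_prod_mul]
    congr 1
    ext p
    rw [← Complex.exp_conj, ← Complex.exp_add]
    simp only [map_mul, Complex.conj_I, Complex.conj_ofReal]
    push_cast
    congr 1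
    ring
  have hcast : ((∫ y, ‖∫ u in (0 : ℝ)..1,
      Complex.exp (Complex.I * (U * (y - α) : ℝ) * u)‖ ^ 2 ∂μ : ℝ) : ℂ) =
      ∫ p : ℝ × ℝ, Complex.exp (-(U * (p.1 - p.2) * α : ℝ) * Complex.I) *
        charFun μ (U * (p.1 - p.2)) ∂(ν.prod ν) := by
    rw [← integral_complex_ofReal]
    simp_rw [hexp]
    rw [integral_integral_swap]
    · congr 1
      ext p
      rw [charFun_apply_real, ← integral_const_mul]
      congr 1
      ext y
      rw [← Complex.exp_add]
      push_cast
      congr 1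
      ring
    · refine Integrable.of_bound (Continuous.aestronglyMeasurable ?_) 1 (ae_of_all _ fun y => ?_)
      · unfold Function.uncurry
        fun_prop
      · simp only [Function.uncurry]
        rw [Complex.norm_exp_ofReal_mul_I]
  have hpt : ∀ᵐ p ∂(ν.prod ν), ‖Complex.exp (-(U * (p.1 - p.2) * α : ℝ) * Complex.I) *
        charFun μ (U * (p.1 - p.2))‖ ≤ Real.exp (-(U ^ 2 / 4) * (p.1 - p.2) ^ 2) := by
    rw [hν, Measure.prod_restrict]
    filter_upwards [ae_restrict_mem (measurableSet_Ioc.prod measurableSet_Ioc)] with p hp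
    rw [norm_mul, ← Complex.ofReal_neg, Complex.norm_exp_ofReal_mul_I, one_mul]
    refine (hμ _ ?_).trans_eq (by ring_nf)
    rw [abs_mul, abs_of_pos hU]
    refine mul_le_of_le_one_right hU.le ?_
    rw [abs_le]
    constructor <;> linarith [hp.1.1, hp.1.2, hp.2.1, hp.2.2]
  have hi : Integrable (fun p : ℝ × ℝ => Real.exp (-(U ^ 2 / 4) * (p.1 - p.2) ^ 2)) (ν.prod ν) := by
    refine Integrable.of_bound (Continuous.aestronglyMeasurable (by fun_prop)) 1
      (ae_of_all _ fun p => ?_)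
    rw [Real.norm_of_nonneg (Real.exp_pos _).le, Real.exp_le_one_iff]
    have : 0 ≤ U ^ 2 / 4 * (p.1 - p.2) ^ 2 := by positivity
    linarith
  have hb : (∫ p : ℝ × ℝ, Real.exp (-(U ^ 2 / 4) * (p.1 - p.2) ^ 2) ∂(ν.prod ν)) ≤
      2 * √Real.pi / U := by
    rw [integral_prod _ hi]
    have hg : ∀ x : ℝ, ∫ y, Real.exp (-(U ^ 2 / 4) * (x - y) ^ 2) ∂ν ≤ 2 * √Real.pi / U := by
      intro x
      have hgi : Integrable fun y : ℝ => Real.exp (-(U ^ 2 / 4) * (x - y) ^ 2) :=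
        (integrable_exp_neg_mul_sq (b := U ^ 2 / 4) (by positivity)).comp_sub_left x
      refine (setIntegral_le_integral hgi (ae_of_all _ fun y => (Real.exp_pos _).le)).trans_eq ?_
      rw [integral_sub_left_eq_self (fun y : ℝ => Real.exp (-(U ^ 2 / 4) * y ^ 2)) volume x,
        integral_gaussian,
        show Real.pi / (U ^ 2 / 4) = Real.pi * (2 / U) ^ 2 by field_simp; norm_num,
        Real.sqrt_mul Real.pi_pos.le, Real.sqrt_sq (by positivity)]
      ring
    calc _ ≤ ∫ x, 2 * √Real.pi / U ∂ν :=
          integral_mono hi.integral_prod_left (integrable_const _) hg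
      _ = 2 * √Real.pi / U := by simp [hν]
  have hnn : 0 ≤ ∫ y, ‖∫ u in (0 : ℝ)..1,
      Complex.exp (Complex.I * (U * (y - α) : ℝ) * u)‖ ^ 2 ∂μ :=
    integral_nonneg fun y => by positivity
  rw [← Real.norm_of_nonneg hnn, ← Complex.norm_real, hcast]
  exact (norm_integral_le_of_norm_le hi hpt).trans hb

/-- Concentration estimate from a Gaussian bound on the characteristic function. -/
theorem integral_inv_sq_le {μ : Measure ℝ} [IsProbabilityMeasure μ] {U : ℝ} (hU : 0 < U)
    (hμ : ∀ t : ℝ, |t| ≤ U → ‖charFun μ t‖ ≤ Real.exp (-t ^ 2 / 4)) (α : ℝ) :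
    ∫ y, 1 / (Real.pi + |U * (y - α)|) ^ 2 ∂μ ≤ √Real.pi / U := by
  have h1 := integral_fejer_le hU hμ α
  -- The shift of the centre by `π / U` produces the translate by `π` after scaling.
  have h2 := integral_fejer_le hU hμ (α - Real.pi / U)
  have i1 := integrable_fejer μ U α
  have i2 := integrable_fejer μ U (α - Real.pi / U)
  have hi : Integrable (fun y => 4 * (1 / (Real.pi + |U * (y - α)|) ^ 2)) μ := by
    refine Integrable.of_bound (Continuous.aestronglyMeasurable ?_) (4 / Real.pi ^ 2)
      (ae_of_all _ fun y => ?_)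
    · refine continuous_const.mul (continuous_const.div (by fun_prop) fun y => ?_)
      have := Real.pi_pos
      positivity
    · have := Real.pi_pos
      rw [Real.norm_of_nonneg (by positivity), mul_one_div]
      gcongr
      linarith [abs_nonneg (U * (y - α))]
  have h3 := integral_mono hi (i1.add i2) fun y => by
    have := four_div_sq_le_fejer (U * (y - α))
    rw [show U * (y - α) + Real.pi = U * (y - (α - Real.pi / U)) by field_simp; ring] at this
    simpa only [mul_one_div, Pi.add_apply] using this
  rw [integral_add' i1 i2, integral_const_mul] at h3
  have : 2 * √Real.pi / U = 2 * (√Real.pi / U) := by ring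
  linarith

/-- If `0 ∈ J`, the error is the integral of `K` outside `[p, q]`, two tails. If `0 ∉ J`, then `[p,
q]` lies on one side of `0` and is contained in a single tail. Whether `J` contains its endpoints is
irrelevant. -/
theorem norm_indicator_sub_integral_kernel_le {K : ℝ → ℂ} {C : ℝ} (hC : 0 ≤ C) (hK : Integrable K)
    (hK1 : ∫ v, K v = 1)
    (hR : ∀ s, 0 ≤ s → ∫ v in Set.Ioi s, ‖K v‖ ≤ C / (Real.pi + s) ^ 2)
    (hL : ∀ s, 0 ≤ s → ∫ v in Set.Iic (-s), ‖K v‖ ≤ C / (Real.pi + s) ^ 2)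
    {J : Set ℝ} {p q : ℝ} (hpq : p ≤ q) (h1 : Set.Ioo p q ⊆ J) (h2 : J ⊆ Set.Icc p q) :
    ‖J.indicator (fun _ => (1 : ℂ)) 0 - ∫ v in p..q, K v‖ ≤
      C / (Real.pi + |p|) ^ 2 + C / (Real.pi + |q|) ^ 2 := by
  have hpi := Real.pi_pos
  have np : 0 ≤ C / (Real.pi + |p|) ^ 2 := by positivity
  have nq : 0 ≤ C / (Real.pi + |q|) ^ 2 := by positivity
  have hIoc : ‖∫ v in p..q, K v‖ ≤ ∫ v in Set.Ioc p q, ‖K v‖ := by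
    rw [intervalIntegral.integral_of_le hpq]
    exact norm_integral_le_integral_norm _
  by_cases h0 : (0 : ℝ) ∈ J
  · obtain ⟨hp, hq⟩ := h2 h0
    rw [Set.indicator_of_mem h0]
    have e : (1 : ℂ) - ∫ v in p..q, K v = (∫ v in Set.Iic p, K v) + ∫ v in Set.Ioi q, K v := by
      rw [← hK1, ← intervalIntegral.integral_Iic_sub_Iic hK.integrableOn hK.integrableOn,
        ← intervalIntegral.integral_Iic_add_Ioi (b := q) hK.integrableOn hK.integrableOn]
      ring
    rw [e]
    refine (norm_add_le _ _).trans (add_le_add ?_ ?_)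
    · refine (norm_integral_le_integral_norm _).trans ?_
      have := hL (-p) (by linarith)
      rwa [neg_neg, ← abs_of_nonpos hp] at this
    · refine (norm_integral_le_integral_norm _).trans ?_
      have := hR q hq
      rwa [abs_of_nonneg hq]
  · rw [Set.indicator_of_notMem h0, zero_sub, norm_neg]
    have h3 : q ≤ 0 ∨ 0 ≤ p := by
      by_contra! h
      exact h0 (h1 ⟨h.2, h.1⟩)
    refine hIoc.trans ?_
    rcases h3 with h | h
    · have := hL (-q) (by linarith)
      rw [neg_neg, ← abs_of_nonpos h] at this
      have hm := setIntegral_mono_set (s := Set.Ioc p q) hK.norm.integrableOn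
        (ae_of_all (volume.restrict (Set.Iic q)) fun v => norm_nonneg (K v))
        (Set.Ioc_subset_Iic_self).eventuallyLE
      linarith
    · have := hR p h
      rw [← abs_of_nonneg h] at this
      have hm := setIntegral_mono_set (s := Set.Ioc p q) hK.norm.integrableOn
        (ae_of_all (volume.restrict (Set.Ioi p)) fun v => norm_nonneg (K v))
        (Set.Ioc_subset_Ioi_self).eventuallyLE
      rw [abs_of_nonneg h] at this np
      rw [abs_of_nonneg h]
      linarith

/-- The decay `2 / |t|` does not depend on the length of the interval; it is what absorbs the factor
`|t|` in the comparison of characteristic functions. -/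
theorem norm_integral_exp_mul_I_le (t p q : ℝ) :
    |t| * ‖∫ r in p..q, Complex.exp ((t * r : ℝ) * Complex.I)‖ ≤ 2 := by
  rcases eq_or_ne t 0 with rfl | ht
  · simp
  have hc : (t : ℂ) * Complex.I ≠ 0 := mul_ne_zero (by exact_mod_cast ht) Complex.I_ne_zero
  have : ∀ r : ℝ, Complex.exp ((t * r : ℝ) * Complex.I) = Complex.exp (t * Complex.I * r) := by
    intro r; push_cast; congr 1; ring
  simp_rw [this]
  rw [integral_exp_mul_complex hc, norm_div, norm_mul, Complex.norm_I, mul_one, Complex.norm_real,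
    Real.norm_eq_abs, mul_div_cancel₀ _ (abs_ne_zero.2 ht)]
  refine (norm_sub_le _ _).trans ?_
  rw [← this, ← this, Complex.norm_exp_ofReal_mul_I, Complex.norm_exp_ofReal_mul_I]
  norm_num

/-- The smoothed indicator as a Fourier integral. -/
theorem integral_kernel_eq_fourier {b K : ℝ → ℂ} (hb : Integrable b)
    (hbK : ∀ v, K v = ∫ u, Complex.exp ((2 * Real.pi * u * v : ℝ) * Complex.I) * b u)
    (c p q : ℝ) (hpq : p ≤ q) :
    ∫ v in (c + p)..(c + q), K v = ∫ u, Complex.exp ((2 * Real.pi * u * c : ℝ) * Complex.I) *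
      ((∫ r in p..q, Complex.exp ((2 * Real.pi * u * r : ℝ) * Complex.I)) * b u) := by
  rw [← intervalIntegral.integral_comp_add_left, intervalIntegral.integral_of_le hpq]
  simp_rw [hbK]
  rw [integral_integral_swap]
  · congr 1
    ext u
    rw [intervalIntegral.integral_of_le hpq, ← integral_mul_const, ← integral_const_mul]
    congr 1
    ext r
    rw [← mul_assoc, ← Complex.exp_add]
    congr 2
    push_cast
    ring
  · have h := (integrable_const (μ := volume.restrict (Set.Ioc p q)) (1 : ℂ)).mul_prod hb
    simp only [one_mul] at h
    exact h.bdd_mul (c := 1) (f := fun z : ℝ × ℝ =>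
      Complex.exp ((2 * Real.pi * z.2 * (c + z.1) : ℝ) * Complex.I))
      (Continuous.aestronglyMeasurable (by fun_prop))
      (ae_of_all _ fun z => by rw [Complex.norm_exp_ofReal_mul_I])

theorem continuous_integral_exp_mul_I (p q : ℝ) :
    Continuous fun t : ℝ => ∫ r in p..q, Complex.exp ((t * r : ℝ) * Complex.I) :=
  intervalIntegral.continuous_parametric_intervalIntegral_of_continuous' (by fun_prop) _ _

theorem norm_integral_exp_mul_I_le_length (t p q : ℝ) :
    ‖∫ r in p..q, Complex.exp ((t * r : ℝ) * Complex.I)‖ ≤ |q - p| := by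
  simpa using intervalIntegral.norm_integral_le_of_norm_le_const (C := 1) (a := p) (b := q)
    (f := fun r : ℝ => Complex.exp ((t * r : ℝ) * Complex.I)) fun r _ => by
      rw [Complex.norm_exp_ofReal_mul_I]

theorem integrable_integral_exp_mul_I_mul {b : ℝ → ℂ} (hb : Integrable b) (p q : ℝ) :
    Integrable fun u : ℝ =>
      (∫ r in p..q, Complex.exp ((2 * Real.pi * u * r : ℝ) * Complex.I)) * b u :=
  hb.bdd_mul (c := |q - p|) (f := fun u : ℝ =>
      ∫ r in p..q, Complex.exp ((2 * Real.pi * u * r : ℝ) * Complex.I))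
    (((continuous_integral_exp_mul_I p q).comp
      (continuous_const.mul continuous_id)).aestronglyMeasurable)
    (ae_of_all _ fun _ => norm_integral_exp_mul_I_le_length _ _ _)

theorem integral_fourier_eq_charFun (μ : Measure ℝ) [IsFiniteMeasure μ] {g : ℝ → ℂ}
    (hg : Integrable g) (U : ℝ) :
    ∫ y, (∫ u, Complex.exp ((2 * Real.pi * u * (U * y) : ℝ) * Complex.I) * g u) ∂μ =
      ∫ u, charFun μ (2 * Real.pi * u * U) * g u := by
  rw [integral_integral_swap]
  · congr 1
    ext u
    rw [integral_mul_const, charFun_apply_real]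
    congr 2
    ext y
    push_cast
    congr 1
    ring
  · have h := (integrable_const (μ := μ) (1 : ℂ)).mul_prod hg
    simp only [one_mul] at h
    exact h.bdd_mul (c := 1) (f := fun z : ℝ × ℝ =>
      Complex.exp ((2 * Real.pi * z.2 * (U * z.1) : ℝ) * Complex.I))
      (Continuous.aestronglyMeasurable (by fun_prop))
      (ae_of_all _ fun z => by rw [Complex.norm_exp_ofReal_mul_I])

/-- The factor `|t|` of the hypothesis cancels the decay of the Fourier transform of an interval,
and a Gaussian integral of order `1 / U` against the factor `U` remains. The bound is thus free of
`U`, `p` and `q`. -/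
theorem norm_integral_charFun_sub_le (μ ν : Measure ℝ) [IsProbabilityMeasure μ]
    [IsProbabilityMeasure ν] {U κ : ℝ} (hU : 0 < U) (hκ : 0 ≤ κ)
    (h : ∀ t : ℝ, |t| ≤ U → ‖charFun μ t - charFun ν t‖ ≤ κ * |t| * Real.exp (-t ^ 2 / 8))
    {b : ℝ → ℂ} (hb : Integrable b) (hb1 : ∀ u, ‖b u‖ ≤ 1)
    (hb0 : ∀ u, 1 < 2 * Real.pi * |u| → b u = 0) (p q : ℝ) :
    ‖(∫ u, charFun μ (2 * Real.pi * u * U) *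
        ((∫ r in p..q, Complex.exp ((2 * Real.pi * u * r : ℝ) * Complex.I)) * b u)) -
      ∫ u, charFun ν (2 * Real.pi * u * U) *
        ((∫ r in p..q, Complex.exp ((2 * Real.pi * u * r : ℝ) * Complex.I)) * b u)‖ ≤ 2 * κ := by
  have hpi := Real.pi_pos
  have hint : ∀ μ : Measure ℝ, IsProbabilityMeasure μ →
      Integrable fun u => charFun μ (2 * Real.pi * u * U) *
        ((∫ r in p..q, Complex.exp ((2 * Real.pi * u * r : ℝ) * Complex.I)) * b u) := by
    intro μ _
    refine (integrable_integral_exp_mul_I_mul hb p q).bdd_mul (c := 1) ?_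
      (ae_of_all _ fun u => norm_charFun_le_one _)
    exact (measurable_charFun.comp (by fun_prop)).aestronglyMeasurable
  rw [← integral_sub (hint μ inferInstance) (hint ν inferInstance)]
  have hg : Integrable fun u : ℝ => 2 * κ * U * Real.exp (-(Real.pi ^ 2 * U ^ 2 / 2) * u ^ 2) :=
    (integrable_exp_neg_mul_sq (by positivity)).const_mul _
  refine (norm_integral_le_of_norm_le hg (ae_of_all _ fun u => ?_)).trans ?_
  · rw [← sub_mul, norm_mul, norm_mul]
    rcases le_or_gt (2 * Real.pi * |u|) 1 with hu | hu
    · have ht : |2 * Real.pi * u * U| = 2 * Real.pi * |u| * U := by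
        rw [abs_mul, abs_mul, abs_of_pos hU, abs_of_pos (show (0:ℝ) < 2 * Real.pi by positivity)]
      have h1 := h (2 * Real.pi * u * U) (by rw [ht]; nlinarith)
      have h2 := norm_integral_exp_mul_I_le (2 * Real.pi * u) p q
      rw [abs_mul, abs_of_pos (show (0:ℝ) < 2 * Real.pi by positivity)] at h2
      rw [ht, show -(2 * Real.pi * u * U) ^ 2 / 8 =
        -(Real.pi ^ 2 * U ^ 2 / 2) * u ^ 2 by ring] at h1
      calc _ ≤ κ * (2 * Real.pi * |u| * U) * Real.exp (-(Real.pi ^ 2 * U ^ 2 / 2) * u ^ 2) *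
            (‖∫ r in p..q, Complex.exp ((2 * Real.pi * u * r : ℝ) * Complex.I)‖ * 1) := by
            gcongr; exact hb1 u
        _ = κ * U * Real.exp (-(Real.pi ^ 2 * U ^ 2 / 2) * u ^ 2) * (2 * Real.pi * |u| *
            ‖∫ r in p..q, Complex.exp ((2 * Real.pi * u * r : ℝ) * Complex.I)‖) := by ring
        _ ≤ κ * U * Real.exp (-(Real.pi ^ 2 * U ^ 2 / 2) * u ^ 2) * 2 := by gcongr
        _ = _ := by ring
    · rw [hb0 u hu, norm_zero, mul_zero, mul_zero]
      positivity
  · rw [integral_const_mul, integral_gaussian,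
      show Real.pi / (Real.pi ^ 2 * U ^ 2 / 2) = (2 / Real.pi) * (1 / U) ^ 2 by field_simp,
      Real.sqrt_mul (by positivity), Real.sqrt_sq (by positivity)]
    have : √(2 / Real.pi) ≤ 1 := by
      refine Real.sqrt_le_one.2 ?_
      rw [div_le_one hpi]
      linarith [Real.pi_gt_three]
    calc 2 * κ * U * (√(2 / Real.pi) * (1 / U)) = 2 * κ * √(2 / Real.pi) := by field_simp
      _ ≤ 2 * κ * 1 := by gcongr
      _ = 2 * κ := mul_one _

/-- Kolmogorov distance on bounded intervals, from closeness of the characteristic functions. -/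
theorem exists_smoothing_const : ∃ C : ℝ, 0 ≤ C ∧ ∀ (μ ν : Measure ℝ) [IsProbabilityMeasure μ]
    [IsProbabilityMeasure ν] (U κ : ℝ), 0 < U → 0 ≤ κ →
    (∀ t : ℝ, |t| ≤ U → ‖charFun μ t‖ ≤ Real.exp (-t ^ 2 / 4)) →
    (∀ t : ℝ, |t| ≤ U → ‖charFun ν t‖ ≤ Real.exp (-t ^ 2 / 4)) →
    (∀ t : ℝ, |t| ≤ U → ‖charFun μ t - charFun ν t‖ ≤ κ * |t| * Real.exp (-t ^ 2 / 8)) →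
    ∀ I : Set ℝ, I.OrdConnected → |μ.real I - ν.real I| ≤ C * (1 / U + κ) := by
  obtain ⟨b, K, C, hC, hbc, hb1, hb0, hb, hbK, hK, hK1, hR, hL⟩ := exists_bandlimited_kernel
  have hpi := Real.pi_pos
  refine ⟨4 * C * √Real.pi + 2, by positivity, fun μ ν _ _ U κ hU hκ hμ hν hd I hI => ?_⟩
  -- Bounded intervals come first, with either choice of endpoints.
  have hbdd : ∀ (J : Set ℝ) (α β : ℝ), α ≤ β → MeasurableSet J → Set.Ioo α β ⊆ J →
      J ⊆ Set.Icc α β →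
      |μ.real J - ν.real J| ≤ (4 * C * √Real.pi + 2) * (1 / U + κ) := by
    intro J α β hαβ hJ hJ1 hJ2
    -- The indicator of `[α, β]` convolved with the kernel `U K(U ·)`.
    set H : ℝ → ℂ := fun y => ∫ v in (U * y + -(U * β))..(U * y + -(U * α)), K v with hH
    have hαβ' : -(U * β) ≤ -(U * α) := by nlinarith
    have hHb : ∀ y, ‖H y‖ ≤ ∫ v, ‖K v‖ := by
      intro y
      rw [hH]
      simp only
      rw [intervalIntegral.integral_of_le (by linarith)]
      exact (norm_integral_le_integral_norm _).trans
        (setIntegral_le_integral hK.norm (ae_of_all _ fun v => norm_nonneg _))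
    have key : ∀ ρ : Measure ℝ, IsProbabilityMeasure ρ →
        (∀ t : ℝ, |t| ≤ U → ‖charFun ρ t‖ ≤ Real.exp (-t ^ 2 / 4)) →
        ‖(ρ.real J : ℂ) - ∫ y, H y ∂ρ‖ ≤ 2 * C * √Real.pi / U ∧
        ∫ y, H y ∂ρ = ∫ u, charFun ρ (2 * Real.pi * u * U) *
        ((∫ r in (-(U * β))..(-(U * α)),
          Complex.exp ((2 * Real.pi * u * r : ℝ) * Complex.I)) * b u) := by
      intro ρ _ hρ
      constructor
      · have hHi : Integrable H ρ := by
          refine Integrable.of_bound (Continuous.aestronglyMeasurable ?_) _ (ae_of_all _ hHb)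
          have : Continuous fun x : ℝ => ∫ v in (0:ℝ)..x, K v :=
            intervalIntegral.continuous_primitive (fun _ _ => hK.intervalIntegrable) 0
          have h2 : H = fun y => (∫ v in (0:ℝ)..(U * y + -(U * α)), K v) -
              ∫ v in (0:ℝ)..(U * y + -(U * β)), K v := by
            ext y
            rw [intervalIntegral.integral_interval_sub_left hK.intervalIntegrable
              hK.intervalIntegrable]
          rw [h2]
          exact (this.comp (by fun_prop)).sub (this.comp (by fun_prop))
        have hind : (ρ.real J : ℂ) = ∫ y, J.indicator (fun _ => (1 : ℂ)) y ∂ρ := by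
          rw [integral_indicator_const _ hJ]
          simp
        have hii : Integrable (J.indicator fun _ => (1 : ℂ)) ρ :=
          (integrable_const _).indicator hJ
        have hq : ∀ γ : ℝ, Integrable (fun y => C * (1 / (Real.pi + |U * (y - γ)|) ^ 2)) ρ := by
          intro γ
          refine Integrable.const_mul (Integrable.of_bound (Continuous.aestronglyMeasurable ?_)
            (1 / Real.pi ^ 2) (ae_of_all _ fun y => ?_)) _
          · refine continuous_const.div (by fun_prop) fun y => ?_
            positivity
          · rw [Real.norm_of_nonneg (by positivity)]
            gcongr
            linarith [abs_nonneg (U * (y - γ))]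
        rw [hind, ← integral_sub hii hHi]
        refine (norm_integral_le_of_norm_le ((hq β).add (hq α)) (ae_of_all _ fun y => ?_)).trans ?_
        -- Recentre at `y` and rescale by `U`: the endpoints become `U (y - β)` and `U (y - α)`, and
        -- the two tail bounds are integrated by the concentration estimate.
        · have hpre : J.indicator (fun _ => (1 : ℂ)) y =
              ((fun s => y - s / U) ⁻¹' J).indicator (fun _ => (1 : ℂ)) 0 := by
            have : (0 : ℝ) ∈ (fun s => y - s / U) ⁻¹' J ↔ y ∈ J := by simp
            by_cases hy : y ∈ J
            · rw [Set.indicator_of_mem hy, Set.indicator_of_mem (this.2 hy)]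
            · rw [Set.indicator_of_notMem hy, Set.indicator_of_notMem (mt this.1 hy)]
          rw [hpre]
          have := norm_indicator_sub_integral_kernel_le hC hK hK1 hR hL
            (J := (fun s => y - s / U) ⁻¹' J) (p := U * y + -(U * β)) (q := U * y + -(U * α))
            (by linarith) ?_ ?_
          · refine this.trans_eq ?_
            simp only [Pi.add_apply]
            rw [mul_one_div, mul_one_div]
            congr 5 <;> ring
          · intro s hs
            apply hJ1
            have h1 : s / U * U = s := by field_simp
            have h3 := hs.1
            have h4 := hs.2
            constructor <;> by_contra! h <;> nlinarith [mul_le_mul_of_nonneg_right h hU.le]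
          · intro s hs
            have h1 : s / U * U = s := by field_simp
            have h2 := mul_le_mul_of_nonneg_right (hJ2 hs).1 hU.le
            have h3 := mul_le_mul_of_nonneg_right (hJ2 hs).2 hU.le
            constructor <;> nlinarith
        · rw [integral_add' (hq β) (hq α), integral_const_mul, integral_const_mul]
          have h1 := mul_le_mul_of_nonneg_left (integral_inv_sq_le hU hρ α) hC
          have h2 := mul_le_mul_of_nonneg_left (integral_inv_sq_le hU hρ β) hC
          have : 2 * C * √Real.pi / U = C * (√Real.pi / U) + C * (√Real.pi / U) := by ring
          linarith
      · rw [← integral_fourier_eq_charFun ρ (integrable_integral_exp_mul_I_mul hb _ _) U]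
        congr 1
        ext y
        exact integral_kernel_eq_fourier hb hbK _ _ _ hαβ'
    obtain ⟨m1, m2⟩ := key μ inferInstance hμ
    obtain ⟨n1, n2⟩ := key ν inferInstance hν
    have hmn := norm_integral_charFun_sub_le μ ν hU hκ hd hb hb1 hb0 (-(U * β)) (-(U * α))
    rw [← m2, ← n2] at hmn
    rw [← Real.norm_eq_abs, ← Complex.norm_real, Complex.ofReal_sub]
    rw [norm_sub_rev] at n1
    have := norm_add₃_le (a := (μ.real J : ℂ) - ∫ y, H y ∂μ)
      (b := (∫ y, H y ∂μ) - ∫ y, H y ∂ν) (c := (∫ y, H y ∂ν) - (ν.real J : ℂ))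
    rw [sub_add_sub_cancel, sub_add_sub_cancel] at this
    have h3 : (4 * C * √Real.pi + 2) * (1 / U + κ) = 2 * C * √Real.pi / U + 2 * κ +
      2 * C * √Real.pi / U + (4 * C * √Real.pi * κ + 2 / U) := by ring
    have h4 : 0 ≤ 4 * C * √Real.pi * κ + 2 / U := by positivity
    linarith
  -- The bound does not depend on the interval, so exhaustion by `[-n, n]` removes boundedness.
  have hlim : ∀ ρ : Measure ℝ, IsProbabilityMeasure ρ →
      Tendsto (fun n : ℕ => ρ.real (I ∩ Set.Icc (-(n:ℝ)) n)) atTop (𝓝 (ρ.real I)) := by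
    intro ρ _
    have hmono : Monotone fun n : ℕ => I ∩ Set.Icc (-(n:ℝ)) n := by
      intro m n hmn
      have : (m : ℝ) ≤ n := by exact_mod_cast hmn
      exact Set.inter_subset_inter_right _ (Set.Icc_subset_Icc (by linarith) this)
    have hU : ⋃ n : ℕ, I ∩ Set.Icc (-(n:ℝ)) n = I := by
      rw [← Set.inter_iUnion]
      refine Set.inter_eq_left.2 fun x _ => ?_
      obtain ⟨n, hn⟩ := exists_nat_ge |x|
      exact Set.mem_iUnion.2 ⟨n, abs_le.1 hn⟩
    have := tendsto_measure_iUnion_atTop (μ := ρ) hmono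
    rw [hU] at this
    exact (ENNReal.tendsto_toReal (measure_ne_top _ _)).comp this
  refine le_of_tendsto ((hlim μ inferInstance).sub (hlim ν inferInstance)).abs
    (Eventually.of_forall fun n => ?_)
  set J := I ∩ Set.Icc (-(n:ℝ)) n
  have hJc : J.OrdConnected := hI.inter Set.ordConnected_Icc
  rcases J.eq_empty_or_nonempty with h | h
  · rw [h]
    simp only [measureReal_empty, sub_self, abs_zero]
    positivity
  · have ha : BddAbove J := bddAbove_Icc.mono Set.inter_subset_right
    have hb' : BddBelow J := bddBelow_Icc.mono Set.inter_subset_right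
    refine hbdd J (sInf J) (sSup J) (csInf_le_csSup h hb' ha) hJc.measurableSet ?_
      (subset_Icc_csInf_csSup hb' ha)
    exact IsConnected.Ioo_csInf_csSup_subset ⟨h, hJc.isPreconnected⟩ hb' ha

/-! ### Exponential integrals over half-lines and the normal tail -/

/-- Layer cake: the integrand has values in `[0, 1]` and its superlevel sets at levels in `(0, 1]`
are intervals, so each integral is an average of measures of intervals. -/
theorem abs_setIntegral_exp_sub_le {μ ν : Measure ℝ} [IsProbabilityMeasure μ]
    [IsProbabilityMeasure ν] {D : ℝ}
    (h : ∀ J : Set ℝ, J.OrdConnected → |μ.real J - ν.real J| ≤ D)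
    {I : Set ℝ} (hI : I.OrdConnected) (hI0 : I ⊆ Set.Ici 0) {a : ℝ} (ha : 0 ≤ a) :
    |(∫ z in I, Real.exp (-(a * z)) ∂μ) - ∫ z in I, Real.exp (-(a * z)) ∂ν| ≤ D := by
  set f : ℝ → ℝ := I.indicator fun z => Real.exp (-(a * z)) with hf
  have hf0 : ∀ z, 0 ≤ f z := fun z => Set.indicator_nonneg (fun _ _ => (Real.exp_pos _).le) z
  have hf1 : ∀ z, f z ≤ 1 := fun z => Set.indicator_apply_le' (fun hz => by
    rw [Real.exp_le_one_iff]
    have := mul_nonneg ha (hI0 hz)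
    linarith) fun _ => zero_le_one
  have hfm : Measurable f := (by fun_prop : Measurable fun z => Real.exp (-(a * z))).indicator
    hI.measurableSet
  have key : ∀ ρ : Measure ℝ, IsProbabilityMeasure ρ → ∫ z in I, Real.exp (-(a * z)) ∂ρ =
      ∫ t in Set.Ioc 0 1, ρ.real {z | t ≤ f z} := by
    intro ρ _
    rw [← integral_indicator hI.measurableSet]
    refine Integrable.integral_eq_integral_Ioc_meas_le ?_ (ae_of_all _ hf0) (ae_of_all _ hf1)
    refine Integrable.of_bound hfm.aestronglyMeasurable 1 (ae_of_all _ fun z => ?_)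
    rw [Real.norm_of_nonneg (hf0 z)]
    exact hf1 z
  have hint : ∀ ρ : Measure ℝ, IsProbabilityMeasure ρ →
      Integrable (fun t => ρ.real {z | t ≤ f z}) (volume.restrict (Set.Ioc 0 1)) := by
    intro ρ _
    refine Integrable.of_bound (Antitone.measurable ?_).aestronglyMeasurable 1
      (ae_of_all _ fun t => ?_)
    · intro s t hst
      exact measureReal_mono fun z hz => hst.trans hz
    · rw [Real.norm_of_nonneg measureReal_nonneg]
      exact measureReal_le_one
  rw [key μ inferInstance, key ν inferInstance,
    ← integral_sub (hint μ inferInstance) (hint ν inferInstance), ← Real.norm_eq_abs]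
  have hb := norm_setIntegral_le_of_norm_le_const (μ := volume) (s := Set.Ioc (0 : ℝ) 1) (C := D)
    (f := fun t => μ.real {z | t ≤ f z} - ν.real {z | t ≤ f z}) (by simp) fun t ht => by
      refine h _ ?_
      -- Here `t > 0` is needed to exclude the points outside `I`, where `f` vanishes.
      have : {z | t ≤ f z} = I ∩ {z | t ≤ Real.exp (-(a * z))} := by
        ext z
        simp only [Set.mem_ofPred_eq, Set.mem_inter_iff, hf, Set.indicator]
        split_ifs with hz
        · simp [hz]
        · simp [hz, ht.1]
      rw [this]
      refine hI.inter (IsLowerSet.ordConnected fun x y hxy hx => ?_)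
      refine le_trans hx (Real.exp_le_exp.2 ?_)
      nlinarith
  simpa using hb

/-- The Laplace transform of the standard normal density on the half-line. -/
def gaussianLaplace (a : ℝ) : ℝ :=
  ∫ y in Set.Ioi 0, Real.exp (-(a * y)) * gaussianPDFReal 0 1 y

theorem gaussianPDFReal_std (y : ℝ) :
    gaussianPDFReal 0 1 y = (√(2 * Real.pi))⁻¹ * Real.exp (-y ^ 2 / 2) := by
  simp [gaussianPDFReal]

theorem gaussianPDFReal_std_le_one (y : ℝ) : gaussianPDFReal 0 1 y ≤ 1 := by
  rw [gaussianPDFReal_std]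
  refine mul_le_one₀ (inv_le_one_of_one_le₀ ?_) (Real.exp_pos _).le ?_
  · rw [Real.one_le_sqrt]
    linarith [Real.pi_gt_three]
  · rw [Real.exp_le_one_iff]
    nlinarith [sq_nonneg y]

theorem integrableOn_gaussianLaplace {a : ℝ} (ha : 0 ≤ a) :
    IntegrableOn (fun y => Real.exp (-(a * y)) * gaussianPDFReal 0 1 y) (Set.Ioi 0) := by
  refine (integrable_gaussianPDFReal 0 1).integrableOn.bdd_mul (c := 1)
    (f := fun y => Real.exp (-(a * y))) (Continuous.aestronglyMeasurable (by fun_prop)) ?_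
  filter_upwards [ae_restrict_mem measurableSet_Ioi] with y hy
  rw [Real.norm_of_nonneg (Real.exp_pos _).le, Real.exp_le_one_iff]
  have := mul_nonneg ha (le_of_lt hy)
  linarith

/-- The endpoint `0` is left free because the upper tail is a closed half-line and the lower one,
after reflection, an open one. -/
theorem setIntegral_exp_gaussianReal {a : ℝ} {I : Set ℝ} (hI : Set.Ioi 0 ⊆ I)
    (hI0 : I ⊆ Set.Ici 0) (hm : MeasurableSet I) :
    ∫ z in I, Real.exp (-(a * z)) ∂(gaussianReal 0 1) = gaussianLaplace a := by
  have hae : I =ᵐ[volume] Set.Ioi (0 : ℝ) :=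
    (hI0.eventuallyLE.trans Ioi_ae_eq_Ici.symm.le).antisymm hI.eventuallyLE
  rw [← integral_indicator hm, integral_gaussianReal_eq_integral_smul one_ne_zero, gaussianLaplace,
    ← setIntegral_congr_set hae, ← integral_indicator hm]
  congr 1
  ext z
  by_cases hz : z ∈ I <;> simp [hz, mul_comm]

/-- Translating the tail integral by `x` factors the density as `e^{-x²/2} e^{-xy} e^{-y²/2}`. So
`gaussianLaplace` is, up to a constant factor, the Mills ratio. -/
theorem one_sub_stdNormalDF_eq (x : ℝ) :
    1 - stdNormalDF x = Real.exp (-x ^ 2 / 2) * gaussianLaplace x := by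
  have h1 : 1 - stdNormalDF x = (gaussianReal 0 1).real (Set.Ioi x) := by
    rw [stdNormalDF, cdf_eq_real, ← Set.compl_Iic, measureReal_compl measurableSet_Iic,
      probReal_univ]
  rw [h1, Measure.real, gaussianReal_apply_eq_integral _ one_ne_zero, ENNReal.toReal_ofReal
    (integral_nonneg fun y => gaussianPDFReal_nonneg _ _ _), gaussianLaplace,
    ← integral_const_mul]
  have := (measurePreserving_add_left volume x).setIntegral_preimage_emb
    (measurableEmbedding_addLeft x) (gaussianPDFReal 0 1) (Set.Ioi x)
  rw [← this]
  have hpre : (fun y => x + y) ⁻¹' Set.Ioi x = Set.Ioi 0 := by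
    ext y; simp
  rw [hpre]
  congr 1
  ext y
  rw [gaussianPDFReal_std, gaussianPDFReal_std]
  have : Real.exp (-(x + y) ^ 2 / 2) =
      Real.exp (-x ^ 2 / 2) * (Real.exp (-(x * y)) * Real.exp (-y ^ 2 / 2)) := by
    rw [← Real.exp_add, ← Real.exp_add]
    congr 1
    ring
  rw [this]
  ring

theorem stdNormalDF_neg (x : ℝ) : stdNormalDF (-x) = 1 - stdNormalDF x := by
  have h1 : 1 - stdNormalDF x = (gaussianReal 0 1).real (Set.Ioi x) := by
    rw [stdNormalDF, cdf_eq_real, ← Set.compl_Iic, measureReal_compl measurableSet_Iic,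
      probReal_univ]
  have h2 : (gaussianReal 0 1).map (fun y => -y) = gaussianReal 0 1 := by
    rw [gaussianReal_map_neg, neg_zero]
  have hn := nullSingletonClass_gaussianReal (μ := 0) (one_ne_zero (α := NNReal))
  rw [h1, stdNormalDF, cdf_eq_real]
  conv_lhs => rw [← h2]
  rw [map_measureReal_apply measurable_neg measurableSet_Iic]
  have : (fun y : ℝ => -y) ⁻¹' Set.Iic (-x) = Set.Ici x := by ext; simp
  rw [this]
  exact measureReal_congr Ioi_ae_eq_Ici.symm

/-- On `(0, 1 / (1 + x)]` both `xy` and `y²/2` are at most `1`. This bound turns an absolute error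
`O(1/T)` into a relative error `O((x + 1)/T)`. -/
theorem exists_le_gaussianLaplace : ∃ c : ℝ, 0 < c ∧ ∀ x : ℝ, 0 ≤ x →
    c / (1 + x) ≤ gaussianLaplace x := by
  refine ⟨Real.exp (-1) * ((√(2 * Real.pi))⁻¹ * Real.exp (-1)), by positivity, fun x hx => ?_⟩
  have hi := integrableOn_gaussianLaplace hx
  have h1 : ∫ y in Set.Ioc 0 (1 / (1 + x)), (Real.exp (-1) * ((√(2 * Real.pi))⁻¹ * Real.exp (-1)))
      ≤ ∫ y in Set.Ioc 0 (1 / (1 + x)), Real.exp (-(x * y)) * gaussianPDFReal 0 1 y := by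
    refine setIntegral_mono_on (integrableOn_const (by simp))
      (hi.mono_set Set.Ioc_subset_Ioi_self) measurableSet_Ioc fun y hy => ?_
    have h2 := (le_div_iff₀ (by positivity)).1 hy.2
    have h3 := hy.1
    have h4 : y ≤ 1 := by nlinarith
    rw [gaussianPDFReal_std]
    gcongr
    · nlinarith
    · nlinarith
  have h2 := setIntegral_mono_set (s := Set.Ioc 0 (1 / (1 + x))) hi
    (ae_of_all _ fun y => mul_nonneg (Real.exp_pos _).le (gaussianPDFReal_nonneg _ _ _))
    (Set.Ioc_subset_Ioi_self).eventuallyLE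
  refine le_trans (le_of_eq ?_) (h1.trans h2)
  rw [setIntegral_const, smul_eq_mul, Measure.real, Real.volume_Ioc,
    ENNReal.toReal_ofReal (by rw [sub_zero]; positivity)]
  ring

/-- The normal density is at most `1`, so the slope is at most `∫ y e^{-my} dy = m⁻²`. This decay
matters: the arguments compared later are of order `T u` and differ by `O(T u²)`. -/
theorem abs_gaussianLaplace_sub_le {a x m : ℝ} (hm : 0 < m) (ha : m ≤ a) (hx : m ≤ x) :
    |gaussianLaplace a - gaussianLaplace x| ≤ |a - x| / m ^ 2 := by
  have hi : IntegrableOn (fun y : ℝ => |a - x| * (y ^ ((2 : ℝ) - 1) * Real.exp (-(m * y))))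
      (Set.Ioi 0) := by
    refine Integrable.const_mul ?_ _
    have := integrableOn_rpow_mul_exp_neg_mul_rpow (p := 1) (s := 1) (b := m) (by norm_num)
      (by norm_num) hm
    refine this.congr_fun (fun y _ => ?_) measurableSet_Ioi
    norm_num
  rw [gaussianLaplace, gaussianLaplace, ← integral_sub (integrableOn_gaussianLaplace (by linarith))
    (integrableOn_gaussianLaplace (by linarith)), ← Real.norm_eq_abs]
  refine (norm_integral_le_of_norm_le hi ?_).trans_eq ?_
  · filter_upwards [ae_restrict_mem measurableSet_Ioi] with y hy
    have hy : 0 < y := hy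
    rw [← sub_mul, norm_mul, Real.norm_of_nonneg (gaussianPDFReal_nonneg _ _ _)]
    have key : ∀ a x : ℝ, m ≤ a → a ≤ x → |Real.exp (-(a * y)) - Real.exp (-(x * y))| ≤
        |a - x| * (y * Real.exp (-(m * y))) := by
      intro a x ha hax
      have h1 : Real.exp (-(x * y)) = Real.exp (-(a * y)) * Real.exp (-((x - a) * y)) := by
        rw [← Real.exp_add]; congr 1; ring
      have h2 := Real.add_one_le_exp (-((x - a) * y))
      have h3 : Real.exp (-(a * y)) ≤ Real.exp (-(m * y)) := by
        rw [Real.exp_le_exp]; nlinarith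
      have h4 : Real.exp (-(x * y)) ≤ Real.exp (-(a * y)) := by
        rw [Real.exp_le_exp]; nlinarith
      rw [abs_of_nonneg (by linarith), abs_of_nonpos (by linarith), h1]
      have h5 : 0 ≤ (x - a) * y := mul_nonneg (by linarith) hy.le
      nlinarith [Real.exp_pos (-(a * y))]
    have h6 : |Real.exp (-(a * y)) - Real.exp (-(x * y))| ≤
        |a - x| * (y * Real.exp (-(m * y))) := by
      rcases le_total a x with h | h
      · exact key a x ha h
      · rw [abs_sub_comm, abs_sub_comm a x]
        exact key x a hx h
    have : y ^ ((2 : ℝ) - 1) = y := by norm_num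
    rw [this]
    exact (mul_le_of_le_one_right (norm_nonneg _) (gaussianPDFReal_std_le_one y)).trans h6
  · rw [integral_const_mul, Real.integral_rpow_mul_exp_neg_mul_Ioi (by norm_num) hm]
    rw [Real.Gamma_two, Real.rpow_two]
    ring

/-! ### Power series with bounded coefficients and their Taylor remainders -/

/-- The complex function with real power series coefficients `a`. -/
def complexSeries (a : ℕ → ℝ) (z : ℂ) : ℂ := ∑' k, (a k : ℂ) * z ^ k

/-- Coefficients bounded by `A` of a series that starts with `z ^ 2 / 2`. -/
structure NormalizedCoeffs (A : ℝ) (a : ℕ → ℝ) : Prop where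
  bound : ∀ k, |a k| ≤ A
  zero : a 0 = 0
  one : a 1 = 0
  two : a 2 = 1 / 2

theorem hasFPowerSeriesOnBall_complexSeries {A : ℝ} {a : ℕ → ℝ} (h : ∀ k, |a k| ≤ A) :
    HasFPowerSeriesOnBall (complexSeries a)
      (FormalMultilinearSeries.ofScalars ℂ fun k => (a k : ℂ)) 0 1 := by
  set p := FormalMultilinearSeries.ofScalars ℂ fun k => (a k : ℂ) with hp
  have hr : ((1 : NNReal) : ENNReal) ≤ p.radius := by
    refine p.le_radius_of_bound A fun n => ?_
    rw [hp, FormalMultilinearSeries.ofScalars_norm, NNReal.coe_one, one_pow, mul_one,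
      Complex.norm_real]
    exact h n
  rw [ENNReal.coe_one] at hr
  have hs : p.sum = complexSeries a := by
    ext z
    rw [hp]
    exact FormalMultilinearSeries.ofScalars_sum_eq _ _
  rw [← hs]
  exact (p.hasFPowerSeriesOnBall (lt_of_lt_of_le one_pos hr)).mono one_pos hr

theorem analyticOnNhd_complexSeries {A : ℝ} {a : ℕ → ℝ} (h : ∀ k, |a k| ≤ A) :
    AnalyticOnNhd ℂ (complexSeries a) (Metric.ball 0 1) := by
  have := (hasFPowerSeriesOnBall_complexSeries h).analyticOnNhd
  rwa [← ENNReal.ofReal_one, Metric.eball_ofReal] at this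

theorem iteratedDeriv_complexSeries {A : ℝ} {a : ℕ → ℝ} (h : ∀ k, |a k| ≤ A) (k : ℕ) :
    iteratedDeriv k (complexSeries a) 0 = k.factorial * a k := by
  have h1 := (hasFPowerSeriesOnBall_complexSeries h).hasFPowerSeriesAt
  have h2 := h1.analyticAt.hasFPowerSeriesAt
  have h3 := congrArg (fun p => FormalMultilinearSeries.coeff p k)
    (h2.eq_formalMultilinearSeries h1)
  simp only [FormalMultilinearSeries.coeff_ofScalars] at h3
  rw [div_eq_iff (by exact_mod_cast k.factorial_ne_zero)] at h3
  rw [h3, mul_comm]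

theorem norm_complexSeries_le {A : ℝ} {a : ℕ → ℝ} (h : ∀ k, |a k| ≤ A) {z : ℂ}
    (hz : ‖z‖ ≤ 3 / 4) :
    ‖complexSeries a z‖ ≤ 4 * A := by
  have hg := (hasSum_geometric_of_lt_one (r := 3 / 4) (by norm_num) (by norm_num)).mul_left A
  refine (tsum_of_norm_bounded hg fun k => ?_).trans_eq (by norm_num; ring)
  rw [norm_mul, norm_pow, Complex.norm_real]
  have hA : 0 ≤ A := (abs_nonneg _).trans (h 0)
  gcongr
  exact h k

theorem complexSeries_ofReal_im (a : ℕ → ℝ) (u : ℝ) : (complexSeries a u).im = 0 := by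
  rw [complexSeries]
  have : ∀ k, (a k : ℂ) * (u : ℂ) ^ k = ((a k * u ^ k : ℝ) : ℂ) := fun k => by push_cast; rfl
  simp_rw [this]
  rw [← Complex.ofReal_tsum, Complex.ofReal_im]

theorem complexSeries_alternating (a : ℕ → ℝ) (z : ℂ) :
    complexSeries (fun k => (-1) ^ k * a k) z = complexSeries a (-z) := by
  simp only [complexSeries]
  congr 1
  ext k
  rw [neg_pow z]
  push_cast
  ring

theorem NormalizedCoeffs.alternating {A : ℝ} {a : ℕ → ℝ} (h : NormalizedCoeffs A a) :
    NormalizedCoeffs A fun k => (-1) ^ k * a k where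
  bound k := by rw [abs_mul, abs_pow, abs_neg, abs_one, one_pow, one_mul]; exact h.bound k
  zero := by simp [h.zero]
  one := by simp [h.one]
  two := by simp [h.two]

theorem NormalizedCoeffs.pos {A : ℝ} {a : ℕ → ℝ} (h : NormalizedCoeffs A a) : 0 < A := by
  have := h.bound 2
  rw [h.two] at this
  refine lt_of_lt_of_le ?_ this
  norm_num

theorem NormalizedCoeffs.deriv_zero {A : ℝ} {a : ℕ → ℝ} (h : NormalizedCoeffs A a) :
    deriv (complexSeries a) 0 = 0 := by
  have := iteratedDeriv_complexSeries h.bound 1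
  simpa [h.one] using this

theorem NormalizedCoeffs.deriv_deriv_zero {A : ℝ} {a : ℕ → ℝ} (h : NormalizedCoeffs A a) :
    deriv (deriv (complexSeries a)) 0 = 1 := by
  have := iteratedDeriv_complexSeries h.bound 2
  rw [iteratedDeriv_succ, iteratedDeriv_one, h.two] at this
  simpa using this

/-- Cauchy's estimate on the circle of radius `1/4` about `z`, where `|g| ≤ 4A`: the constant is `3!
· 4³ · 4 = 1536`. -/
theorem norm_thirdDeriv_complexSeries_le {A : ℝ} {a : ℕ → ℝ} (h : ∀ k, |a k| ≤ A)
    {z : ℂ} (hz : ‖z‖ ≤ 1 / 2) :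
    ‖deriv (deriv (deriv (complexSeries a))) z‖ ≤ 1536 * A := by
  have hsub : Metric.closedBall z (1 / 4) ⊆ Metric.ball 0 1 := by
    intro y hy
    rw [mem_closedBall_iff_norm] at hy
    rw [mem_ball_zero_iff]
    have := norm_add_le (y - z) z
    rw [sub_add_cancel] at this
    linarith
  have := Complex.norm_iteratedDeriv_le_of_forall_mem_sphere_norm_le (c := z) (R := 1 / 4)
    (C := 4 * A) (f := complexSeries a) 3 (by norm_num) ?_ fun y hy => ?_
  · rw [iteratedDeriv_succ, iteratedDeriv_succ, iteratedDeriv_one] at this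
    refine this.trans_eq ?_
    norm_num [Nat.factorial]
    ring
  · refine DifferentiableOn.diffContOnCl_ball (U := Metric.ball 0 1) ?_ hsub
    exact (analyticOnNhd_complexSeries h).differentiableOn
  · refine norm_complexSeries_le h ?_
    rw [mem_sphere_iff_norm] at hy
    have := norm_add_le (y - z) z
    rw [sub_add_cancel] at this
    linarith

/-- Integration of a power bound on the derivative. -/
theorem norm_sub_le_of_norm_deriv_le_pow {f : ℂ → ℂ} {s : Set ℂ} (hs : Convex ℝ s)
    (hf : ∀ z ∈ s, DifferentiableAt ℂ f z) {w : ℂ} (hw : w ∈ s) {M : ℝ} (hM : 0 ≤ M) {k : ℕ}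
    (hd : ∀ z ∈ s, ‖deriv f z‖ ≤ M * ‖z - w‖ ^ k) {z : ℂ} (hz : z ∈ s) :
    ‖f z - f w‖ ≤ M * ‖z - w‖ ^ (k + 1) := by
  have := Convex.norm_image_sub_le_of_norm_deriv_le (f := f) (s := s ∩ Metric.closedBall w ‖z - w‖)
    (x := w) (y := z) (C := M * ‖z - w‖ ^ k) (fun y hy => hf y hy.1) (fun y hy => ?_)
    (hs.inter (convex_closedBall _ _)) ⟨hw, Metric.mem_closedBall_self (norm_nonneg _)⟩
    ⟨hz, mem_closedBall_iff_norm.2 le_rfl⟩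
  · rwa [pow_succ, ← mul_assoc]
  · refine (hd y hy.1).trans ?_
    have := mem_closedBall_iff_norm.1 hy.2
    gcongr

theorem NormalizedCoeffs.analyticAt {A : ℝ} {a : ℕ → ℝ} (h : NormalizedCoeffs A a) {z : ℂ}
    (hz : ‖z‖ < 1) : AnalyticAt ℂ (complexSeries a) z :=
  analyticOnNhd_complexSeries h.bound z (mem_ball_zero_iff.2 hz)

/-- This and the next two estimates integrate the bound on the third derivative once, twice and
three times; the factorials that integration would gain are dropped. The base point `w` is arbitrary
because the expansion is needed both at `0` and at a saddle point. -/
theorem NormalizedCoeffs.taylor_two {A : ℝ} {a : ℕ → ℝ} (h : NormalizedCoeffs A a)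
    {w z : ℂ} (hw : ‖w‖ ≤ 1 / 2) (hz : ‖z‖ ≤ 1 / 2) :
    ‖deriv (deriv (complexSeries a)) z - deriv (deriv (complexSeries a)) w‖ ≤
      1536 * A * ‖z - w‖ := by
  have hA := h.pos
  have := norm_sub_le_of_norm_deriv_le_pow (convex_closedBall (0 : ℂ) (1 / 2))
    (f := deriv (deriv (complexSeries a))) (w := w) (M := 1536 * A) (k := 0) (fun y hy => ?_)
    (mem_closedBall_zero_iff.2 hw) (by positivity) (fun y hy => ?_) (mem_closedBall_zero_iff.2 hz)
  · simpa using this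
  · rw [mem_closedBall_zero_iff] at hy
    exact (h.analyticAt (by linarith)).deriv.deriv.differentiableAt
  · rw [mem_closedBall_zero_iff] at hy
    simpa using norm_thirdDeriv_complexSeries_le h.bound hy

theorem NormalizedCoeffs.taylor_one {A : ℝ} {a : ℕ → ℝ} (h : NormalizedCoeffs A a)
    {w z : ℂ} (hw : ‖w‖ ≤ 1 / 2) (hz : ‖z‖ ≤ 1 / 2) :
    ‖deriv (complexSeries a) z - deriv (complexSeries a) w -
      deriv (deriv (complexSeries a)) w * (z - w)‖ ≤ 1536 * A * ‖z - w‖ ^ 2 := by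
  have hA := h.pos
  have hd : ∀ y : ℂ, ‖y‖ ≤ 1 / 2 → HasDerivAt (fun y => deriv (complexSeries a) y -
      deriv (deriv (complexSeries a)) w * (y - w))
      (deriv (deriv (complexSeries a)) y - deriv (deriv (complexSeries a)) w) y := by
    intro y hy
    have h1 := (h.analyticAt (z := y) (by linarith)).deriv.differentiableAt.hasDerivAt
    have h2 := ((hasDerivAt_id y).sub_const w).const_mul (deriv (deriv (complexSeries a)) w)
    exact (h1.sub h2).congr_deriv (by simp)
  have := norm_sub_le_of_norm_deriv_le_pow (convex_closedBall (0 : ℂ) (1 / 2))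
    (f := fun y => deriv (complexSeries a) y - deriv (deriv (complexSeries a)) w * (y - w))
    (w := w) (M := 1536 * A) (k := 1) (fun y hy => ?_)
    (mem_closedBall_zero_iff.2 hw) (by positivity) (fun y hy => ?_) (mem_closedBall_zero_iff.2 hz)
  · simpa [sub_right_comm] using this
  · exact (hd y (mem_closedBall_zero_iff.1 hy)).differentiableAt
  · rw [(hd y (mem_closedBall_zero_iff.1 hy)).deriv, pow_one]
    exact h.taylor_two hw (mem_closedBall_zero_iff.1 hy)

theorem NormalizedCoeffs.taylor_zero {A : ℝ} {a : ℕ → ℝ} (h : NormalizedCoeffs A a)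
    {w z : ℂ} (hw : ‖w‖ ≤ 1 / 2) (hz : ‖z‖ ≤ 1 / 2) :
    ‖complexSeries a z - complexSeries a w - deriv (complexSeries a) w * (z - w) -
      deriv (deriv (complexSeries a)) w * (z - w) ^ 2 / 2‖ ≤ 1536 * A * ‖z - w‖ ^ 3 := by
  have hA := h.pos
  have hd : ∀ y : ℂ, ‖y‖ ≤ 1 / 2 → HasDerivAt (fun y => complexSeries a y -
      deriv (complexSeries a) w * (y - w) - deriv (deriv (complexSeries a)) w * (y - w) ^ 2 / 2)
      (deriv (complexSeries a) y - deriv (complexSeries a) w -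
        deriv (deriv (complexSeries a)) w * (y - w)) y := by
    intro y hy
    have h1 := (h.analyticAt (z := y) (by linarith)).differentiableAt.hasDerivAt
    have h2 := ((hasDerivAt_id y).sub_const w).const_mul (deriv (complexSeries a) w)
    have h3 := ((((hasDerivAt_id y).sub_const w).pow 2).const_mul
      (deriv (deriv (complexSeries a)) w)).div_const 2
    refine ((h1.sub h2).sub h3).congr_deriv ?_
    simp
    ring
  have := norm_sub_le_of_norm_deriv_le_pow (convex_closedBall (0 : ℂ) (1 / 2))
    (f := fun y => complexSeries a y - deriv (complexSeries a) w * (y - w) -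
      deriv (deriv (complexSeries a)) w * (y - w) ^ 2 / 2)
    (w := w) (M := 1536 * A) (k := 2) (fun y hy => ?_)
    (mem_closedBall_zero_iff.2 hw) (by positivity) (fun y hy => ?_) (mem_closedBall_zero_iff.2 hz)
  · simp only [sub_self, mul_zero, ne_eq, OfNat.ofNat_ne_zero, not_false_eq_true, zero_pow,
      zero_div, sub_zero] at this
    refine le_of_eq_of_le (congrArg _ ?_) this
    ring
  · exact (hd y (mem_closedBall_zero_iff.1 hy)).differentiableAt
  · rw [(hd y (mem_closedBall_zero_iff.1 hy)).deriv]
    exact h.taylor_one hw (mem_closedBall_zero_iff.1 hy)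

theorem deriv_im_eq_zero_of_real {f : ℂ → ℂ} {u : ℝ} (hf : DifferentiableAt ℂ f u)
    (h : ∀ᶠ x : ℝ in 𝓝 u, (f x).im = 0) : (deriv f u).im = 0 := by
  have h1 := Complex.imCLM.hasFDerivAt.comp_hasDerivAt u hf.hasDerivAt.comp_ofReal
  have h2 : HasDerivAt (fun x : ℝ => (f x).im) 0 u :=
    (hasDerivAt_const u (0 : ℝ)).congr_of_eventuallyEq (h.mono fun x hx => hx)
  exact HasDerivAt.unique h1 h2

theorem eventually_abs_lt_one {u : ℝ} (hu : |u| < 1) : ∀ᶠ x : ℝ in 𝓝 u, |x| < 1 :=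
  (continuous_abs.tendsto u).eventually (gt_mem_nhds hu)

theorem NormalizedCoeffs.deriv_ofReal_im {A : ℝ} {a : ℕ → ℝ} (h : NormalizedCoeffs A a)
    {u : ℝ} (hu : |u| < 1) : (deriv (complexSeries a) u).im = 0 :=
  deriv_im_eq_zero_of_real (h.analyticAt (by simpa using hu)).differentiableAt
    (Eventually.of_forall fun x => complexSeries_ofReal_im a x)

theorem NormalizedCoeffs.deriv_deriv_ofReal_im {A : ℝ} {a : ℕ → ℝ} (h : NormalizedCoeffs A a)
    {u : ℝ} (hu : |u| < 1) : (deriv (deriv (complexSeries a)) u).im = 0 :=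
  deriv_im_eq_zero_of_real (h.analyticAt (by simpa using hu)).deriv.differentiableAt
    ((eventually_abs_lt_one hu).mono fun _ hx => h.deriv_ofReal_im hx)

/-! ### The saddle point equation -/

/-- The radius of the disc on which the saddle point equation is solved. -/
def saddleRadius (A : ℝ) : ℝ := 1 / (4 * (1536 * A + 1))

theorem saddleRadius_pos {A : ℝ} (hA : 0 < A) : 0 < saddleRadius A := by
  unfold saddleRadius; positivity

theorem saddleRadius_le {A : ℝ} (hA : 0 < A) : saddleRadius A ≤ 1 / 4 := by
  unfold saddleRadius
  gcongr
  linarith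

/-- This is what the radius is made for: it keeps `g''` within `1/4` of `g''(0) = 1`. -/
theorem mul_saddleRadius_le {A : ℝ} (hA : 0 < A) : 1536 * A * saddleRadius A ≤ 1 / 4 := by
  unfold saddleRadius
  rw [mul_one_div, div_le_div_iff₀ (by positivity) (by positivity)]
  linarith

/-- The derivative `g'' - 1` of `g' - id` has norm at most `1/4` on the disc. So `g'` is a small
Lipschitz perturbation of the identity, on a disc depending only on `A`. -/
theorem NormalizedCoeffs.norm_deriv_sub_le {A : ℝ} {a : ℕ → ℝ} (h : NormalizedCoeffs A a)
    {z w : ℂ} (hz : ‖z‖ ≤ saddleRadius A) (hw : ‖w‖ ≤ saddleRadius A) :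
    ‖deriv (complexSeries a) z - deriv (complexSeries a) w - (z - w)‖ ≤ 1 / 4 * ‖z - w‖ := by
  have hr := saddleRadius_le h.pos
  have hd : ∀ y ∈ Metric.closedBall (0 : ℂ) (saddleRadius A),
      HasDerivAt (fun y => deriv (complexSeries a) y - y)
      (deriv (deriv (complexSeries a)) y - 1) y := fun y hy => by
    have hy1 := (h.analyticAt (z := y) (by linarith [mem_closedBall_zero_iff.1 hy])).deriv
    exact hy1.differentiableAt.hasDerivAt.sub (hasDerivAt_id y)
  have := Convex.norm_image_sub_le_of_norm_deriv_le (f := fun y => deriv (complexSeries a) y - y)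
    (C := 1 / 4) (fun y hy => (hd y hy).differentiableAt) (fun y hy => ?_)
    (convex_closedBall (0 : ℂ) (saddleRadius A))
    (mem_closedBall_zero_iff.2 hw) (mem_closedBall_zero_iff.2 hz)
  · refine le_of_eq_of_le (congrArg _ ?_) this
    ring
  · rw [(hd y hy).deriv]
    have hy' := mem_closedBall_zero_iff.1 hy
    have := h.taylor_two (w := 0) (z := y) (by simp) (by linarith)
    rw [h.deriv_deriv_zero, sub_zero] at this
    have h2 := mul_saddleRadius_le h.pos
    have h3 := mul_le_mul_of_nonneg_left hy' (by linarith [h.pos] : 0 ≤ 1536 * A)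
    linarith

/-- Injectivity of `g'` on the disc in quantitative form; every uniqueness statement about saddle
points comes from it. -/
theorem NormalizedCoeffs.norm_sub_le_deriv {A : ℝ} {a : ℕ → ℝ} (h : NormalizedCoeffs A a)
    {z w : ℂ} (hz : ‖z‖ ≤ saddleRadius A) (hw : ‖w‖ ≤ saddleRadius A) :
    ‖z - w‖ ≤ 4 / 3 * ‖deriv (complexSeries a) z - deriv (complexSeries a) w‖ := by
  have h1 := h.norm_deriv_sub_le hz hw
  have h2 := norm_sub_le (deriv (complexSeries a) z - deriv (complexSeries a) w)
    (deriv (complexSeries a) z - deriv (complexSeries a) w - (z - w))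
  rw [sub_sub_cancel] at h2
  linarith

/-- The solution of the saddle point equation, holomorphic on a disc of explicit radius. -/
theorem NormalizedCoeffs.exists_saddle {A : ℝ} {a : ℕ → ℝ} (h : NormalizedCoeffs A a) :
    ∃ w : ℂ → ℂ, (∀ t ∈ Metric.ball (0 : ℂ) (saddleRadius A / 2),
      ‖w t‖ < saddleRadius A ∧ deriv (complexSeries a) (w t) = t) ∧
      DifferentiableOn ℂ w (Metric.ball 0 (saddleRadius A / 2)) := by
  set r := saddleRadius A with hr
  have hr0 : 0 < r := saddleRadius_pos h.pos
  have hr1 := saddleRadius_le h.pos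
  have happ : ApproximatesLinearOn (deriv (complexSeries a))
      ((ContinuousLinearEquiv.refl ℂ ℂ : ℂ ≃L[ℂ] ℂ) : ℂ →L[ℂ] ℂ)
      (Metric.closedBall 0 r) (1 / 4) := by
    intro z hz w hw
    simpa using h.norm_deriv_sub_le (mem_closedBall_zero_iff.1 hz) (mem_closedBall_zero_iff.1 hw)
  -- The image of the disc of radius `r` covers radius `(1 - 1/4) r > r/2`, and the preimage has
  -- norm at most `(4/3)(r/2) < r`.
  have hsurj : ∀ t : ℂ, ‖t‖ < r / 2 → ∃ z, ‖z‖ < r ∧ deriv (complexSeries a) z = t := by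
    intro t ht
    have hs := happ.surjOn_closedBall_of_nonlinearRightInverse
      (ContinuousLinearEquiv.toNonlinearRightInverse (ContinuousLinearEquiv.refl ℂ ℂ))
      (ε := r) (b := 0) hr0.le subset_rfl
    rw [h.deriv_zero] at hs
    have hmem : t ∈ Metric.closedBall (0 : ℂ)
        (((((ContinuousLinearEquiv.refl ℂ ℂ).toNonlinearRightInverse.nnnorm : NNReal) : ℝ)⁻¹ -
          ((1 / 4 : NNReal) : ℝ)) * r) := by
      rw [mem_closedBall_zero_iff]
      have : ((ContinuousLinearEquiv.refl ℂ ℂ).toNonlinearRightInverse.nnnorm : ℝ) = 1 := by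
        simp [ContinuousLinearEquiv.toNonlinearRightInverse]
      rw [this]
      norm_num
      linarith
    obtain ⟨z, hz, hzt⟩ := hs hmem
    refine ⟨z, ?_, hzt⟩
    have := h.norm_sub_le_deriv (mem_closedBall_zero_iff.1 hz) (w := 0) (by simpa using hr0.le)
    rw [h.deriv_zero, sub_zero, sub_zero, hzt] at this
    linarith
  choose! w hw using hsurj
  refine ⟨w, fun t ht => hw t (mem_ball_zero_iff.1 ht), fun t ht => ?_⟩
  have ht' := mem_ball_zero_iff.1 ht
  have hnhds : ∀ᶠ s in 𝓝 t, ‖s‖ < r / 2 :=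
    eventually_of_mem (Metric.isOpen_ball.mem_nhds ht) fun s hs => mem_ball_zero_iff.1 hs
  have hcont : ContinuousAt w t := by
    rw [Metric.continuousAt_iff']
    intro ε hε
    have h1 : ∀ᶠ s in 𝓝 t, dist s t < ε / 2 := Metric.ball_mem_nhds t (by positivity)
    filter_upwards [hnhds, h1] with s hs hst
    have := h.norm_sub_le_deriv (hw s hs).1.le (hw t ht').1.le
    rw [(hw s hs).2, (hw t ht').2] at this
    rw [dist_eq_norm] at hst ⊢
    linarith
  have hwt := (hw t ht').1
  have hne : deriv (deriv (complexSeries a)) (w t) ≠ 0 := by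
    intro h0
    have h1 := h.taylor_two (w := 0) (z := w t) (by simp) (by linarith)
    rw [h.deriv_deriv_zero, h0, sub_zero, zero_sub, norm_neg, norm_one] at h1
    have h2 := mul_saddleRadius_le h.pos
    have h3 := mul_le_mul_of_nonneg_left hwt.le (by linarith [h.pos] : 0 ≤ 1536 * A)
    linarith
  exact (HasDerivAt.of_local_left_inverse hcont
    (h.analyticAt (by linarith)).deriv.differentiableAt.hasDerivAt hne
    (hnhds.mono fun s hs => (hw s hs).2)).differentiableAt.differentiableWithinAt

/-! ### The Legendre transform and the Cramér series -/

open Classical in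
/-- The local inverse at `0` of the derivative of the series with coefficients `a`. -/
def saddlePoint (a : ℕ → ℝ) : ℂ → ℂ :=
  if h : HasStrictDerivAt (deriv (complexSeries a)) 1 0 then h.localInverse _ _ _ one_ne_zero else 0

/-- The defect of the Legendre transform from the quadratic one. -/
def legendreDefect (g w : ℂ → ℂ) (t : ℂ) : ℂ := t ^ 2 / 2 + g (w t) - t * w t

/-- The coefficients of the Cramér series attached to normalized cumulants. -/
def cramerCoeff (a : ℕ → ℝ) (k : ℕ) : ℝ :=
  (iteratedDeriv (k + 3) (legendreDefect (complexSeries a) (saddlePoint a)) 0 /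
    (k + 3).factorial).re

/-- The coefficients must be a function of `a` alone, while `w` is chosen on a disc depending on
`A`. Injectivity of `g'` gives `w ∘ g' = id` near `0`, so `w` has the germ of the local inverse, and
`cramerCoeff` sees only that germ. -/
theorem NormalizedCoeffs.saddlePoint_eventuallyEq {A : ℝ} {a : ℕ → ℝ} (h : NormalizedCoeffs A a)
    {w : ℂ → ℂ} (hw : ∀ t ∈ Metric.ball (0 : ℂ) (saddleRadius A / 2),
      ‖w t‖ < saddleRadius A ∧ deriv (complexSeries a) (w t) = t) :
    w =ᶠ[𝓝 0] saddlePoint a := by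
  have hr0 := saddleRadius_pos h.pos
  have han := (h.analyticAt (z := 0) (by simp)).deriv
  have hs : HasStrictDerivAt (deriv (complexSeries a)) 1 0 := by
    have := han.hasStrictDerivAt
    rwa [h.deriv_deriv_zero] at this
  have hc : Tendsto (deriv (complexSeries a)) (𝓝 0) (𝓝 0) := by
    have := han.continuousAt.tendsto
    rwa [h.deriv_zero] at this
  have hev : ∀ᶠ z in 𝓝 (0 : ℂ), w (deriv (complexSeries a) z) = z := by
    filter_upwards [hc.eventually (Metric.ball_mem_nhds 0 (half_pos hr0)),
      Metric.ball_mem_nhds (0 : ℂ) hr0] with z hz hzr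
    obtain ⟨h1, h2⟩ := hw _ hz
    have := h.norm_sub_le_deriv h1.le (mem_ball_zero_iff.1 hzr).le
    rw [h2, sub_self, norm_zero, mul_zero] at this
    exact sub_eq_zero.1 (norm_le_zero_iff.1 this)
  have := HasStrictFDerivAt.localInverse_unique
    (hf := hs.hasStrictFDerivAt_equiv one_ne_zero) hev
  rw [h.deriv_zero] at this
  rw [saddlePoint, dif_pos hs]
  exact this

/-- The terms containing `w'` cancel because `g'(w t) = t`. -/
theorem NormalizedCoeffs.hasDerivAt_legendreDefect {A : ℝ} {a : ℕ → ℝ} (h : NormalizedCoeffs A a)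
    {w : ℂ → ℂ} (hw : ∀ t ∈ Metric.ball (0 : ℂ) (saddleRadius A / 2),
      ‖w t‖ < saddleRadius A ∧ deriv (complexSeries a) (w t) = t)
    (hd : DifferentiableOn ℂ w (Metric.ball 0 (saddleRadius A / 2)))
    {t : ℂ} (ht : t ∈ Metric.ball (0 : ℂ) (saddleRadius A / 2)) :
    HasDerivAt (legendreDefect (complexSeries a) w) (t - w t) t := by
  have h1 := (hd.differentiableAt (Metric.isOpen_ball.mem_nhds ht)).hasDerivAt
  have hr := saddleRadius_le h.pos
  have h2 := (h.analyticAt (z := w t) (by linarith [(hw t ht).1])).differentiableAt.hasDerivAt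
  rw [(hw t ht).2] at h2
  have h3 := (((hasDerivAt_id t).pow 2).div_const 2).add (h2.comp t h1)
  refine (h3.sub ((hasDerivAt_id t).mul h1)).congr_deriv ?_
  simp

/-- Used with uniqueness to show that the saddle point of a real argument is real. -/
theorem deriv_complexSeries_conj (a : ℕ → ℝ) (z : ℂ) :
    deriv (complexSeries a) ((starRingEnd ℂ) z) = (starRingEnd ℂ) (deriv (complexSeries a) z) := by
  have : complexSeries a = (starRingEnd ℂ) ∘ complexSeries a ∘ (starRingEnd ℂ) := by
    ext z
    simp only [complexSeries, Function.comp_apply, Complex.conj_tsum]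
    congr 1
    ext k
    simp
  conv_lhs => rw [this]
  rw [deriv_conj_conj]
  simp

/-- Taylor expansion and uniform bounds for the Cramér series. -/
theorem exists_cramerSeries {A : ℝ} (hA : 0 < A) : ∃ ρ > 0, ∃ K : ℝ, ∀ a, NormalizedCoeffs A a →
    (∀ t : ℂ, ‖t‖ < ρ → Summable (fun k => (cramerCoeff a k : ℂ) * t ^ k) ∧
      ‖∑' k, (cramerCoeff a k : ℂ) * t ^ k‖ ≤ K) ∧
    ∀ t : ℝ, |t| < ρ → ∃ u : ℝ, |u| ≤ saddleRadius A ∧ (0 ≤ t → 0 ≤ u) ∧ (t ≤ 0 → u ≤ 0) ∧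
      deriv (complexSeries a) u = t ∧
      t ^ 3 * seriesValue (cramerCoeff a) t = t ^ 2 / 2 + (complexSeries a u).re - t * u := by
  set r := saddleRadius A with hr
  have hr0 : 0 < r := saddleRadius_pos hA
  have hr1 : r ≤ 1 / 4 := saddleRadius_le hA
  set M := 1 + 4 * A with hM
  -- The defect is bounded by `M` for `|t| < r/2`. Cauchy's estimate at radius `r/4` gives
  -- coefficients at most `M (4/r)^(k+3)`, and for `|t| < r/8` the series is dominated by a
  -- geometric one of ratio `1/2` and sum `2`.
  refine ⟨r / 8, by positivity, M / (r / 4) ^ 3 * 2, fun a h => ?_⟩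
  obtain ⟨w, hw, hwd⟩ := h.exists_saddle
  set Λ := legendreDefect (complexSeries a) w with hΛ
  have hder : ∀ t ∈ Metric.ball (0 : ℂ) (r / 2), HasDerivAt Λ (t - w t) t :=
    fun t ht => h.hasDerivAt_legendreDefect hw hwd ht
  have h0mem : (0 : ℂ) ∈ Metric.ball (0 : ℂ) (r / 2) := Metric.mem_ball_self (by positivity)
  have hΛd : DifferentiableOn ℂ Λ (Metric.ball 0 (r / 2)) :=
    fun t ht => (hder t ht).differentiableAt.differentiableWithinAt
  have hw0 : w 0 = 0 := by
    have := h.norm_sub_le_deriv (hw 0 h0mem).1.le (w := 0) (by simpa using hr0.le)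
    rw [(hw 0 h0mem).2, h.deriv_zero] at this
    simpa using this
  have hΛb : ∀ t ∈ Metric.ball (0 : ℂ) (r / 2), ‖Λ t‖ ≤ M := by
    intro t ht
    have h1 := (hw t ht).1
    have h2 := mem_ball_zero_iff.1 ht
    rw [hΛ, legendreDefect]
    have h3 : ‖complexSeries a (w t)‖ ≤ 4 * A := norm_complexSeries_le h.bound (by linarith)
    have h4 : ‖t ^ 2 / 2‖ ≤ 1 / 2 := by
      rw [norm_div, norm_pow, Complex.norm_ofNat]
      have : ‖t‖ ^ 2 ≤ 1 := pow_le_one₀ (norm_nonneg _) (by linarith)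
      linarith
    have h5 : ‖t * w t‖ ≤ 1 / 2 := by
      rw [norm_mul]
      nlinarith [norm_nonneg t, norm_nonneg (w t)]
    have h6 := norm_sub_le (t ^ 2 / 2 + complexSeries a (w t)) (t * w t)
    have h7 := norm_add_le (t ^ 2 / 2) (complexSeries a (w t))
    linarith
  have hΛe : Λ =ᶠ[𝓝 0] legendreDefect (complexSeries a) (saddlePoint a) := by
    filter_upwards [h.saddlePoint_eventuallyEq hw] with t ht
    rw [hΛ, legendreDefect, legendreDefect, ht]
  have hΛ0 : Λ 0 = 0 := by
    rw [hΛ, legendreDefect, hw0]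
    have := iteratedDeriv_complexSeries h.bound 0
    rw [iteratedDeriv_zero, h.zero] at this
    simp [this]
  have hΛe1 : deriv Λ =ᶠ[𝓝 0] fun t => t - w t := by
    filter_upwards [Metric.isOpen_ball.mem_nhds h0mem] with t ht
    exact (hder t ht).deriv
  have hΛ1 : iteratedDeriv 1 Λ 0 = 0 := by
    rw [iteratedDeriv_one, hΛe1.eq_of_nhds, hw0, sub_zero]
  -- Differentiating `g'(w t) = t` at `0`, where `g'' = 1`, gives `w'(0) = 1`.
  have hΛ2 : iteratedDeriv 2 Λ 0 = 0 := by
    rw [iteratedDeriv_succ, iteratedDeriv_one, hΛe1.deriv_eq]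
    have hwa := (hwd.differentiableAt (Metric.isOpen_ball.mem_nhds h0mem)).hasDerivAt
    have hg := (h.analyticAt (z := w 0) (by rw [hw0]; simp)).deriv.differentiableAt.hasDerivAt
    have hcomp := hg.comp 0 hwa
    rw [hw0, h.deriv_deriv_zero, one_mul] at hcomp
    have hid : HasDerivAt (deriv (complexSeries a) ∘ w) 1 0 := by
      refine (hasDerivAt_id (0 : ℂ)).congr_of_eventuallyEq ?_
      filter_upwards [Metric.isOpen_ball.mem_nhds h0mem] with t ht
      exact (hw t ht).2
    have h1 := hcomp.unique hid
    rw [h1] at hwa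
    exact ((hasDerivAt_id (0 : ℂ)).sub hwa).deriv.trans (sub_self 1)
  set b : ℕ → ℂ := fun k => iteratedDeriv (k + 3) Λ 0 / (k + 3).factorial with hb
  have hcb : ∀ k, cramerCoeff a k = (b k).re := by
    intro k
    rw [cramerCoeff, ← hΛe.iteratedDeriv_eq (k + 3)]
  have hbb : ∀ k, ‖b k‖ ≤ M / (r / 4) ^ 3 * (4 / r) ^ k := by
    intro k
    have h1 := Complex.norm_iteratedDeriv_le_of_forall_mem_sphere_norm_le (c := 0) (R := r / 4)
      (C := M) (f := Λ) (k + 3) (by positivity) ?_ fun z hz => hΛb z ?_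
    · rw [hb]
      simp only
      rw [norm_div, Complex.norm_natCast, div_le_iff₀ (by exact_mod_cast (k + 3).factorial_pos)]
      refine h1.trans_eq ?_
      rw [← inv_div r 4, inv_pow, pow_add]
      ring
    · exact DifferentiableOn.diffContOnCl_ball hΛd (Metric.closedBall_subset_ball (by linarith))
    · exact Metric.sphere_subset_closedBall.trans
        (Metric.closedBall_subset_ball (by linarith)) hz
  have hgeo : ∀ (c : ℕ → ℂ), (∀ k, ‖c k‖ ≤ ‖b k‖) → ∀ t : ℂ, ‖t‖ < r / 8 → ∀ k,
      ‖c k * t ^ k‖ ≤ M / (r / 4) ^ 3 * (1 / 2) ^ k := by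
    intro c hc t ht k
    have hM0 : 0 < M := by positivity
    rw [norm_mul, norm_pow]
    calc ‖c k‖ * ‖t‖ ^ k ≤ (M / (r / 4) ^ 3 * (4 / r) ^ k) * (r / 8) ^ k := by
          gcongr
          exact (hc k).trans (hbb k)
      _ = M / (r / 4) ^ 3 * (1 / 2) ^ k := by
          rw [mul_assoc, ← mul_pow]
          congr 2
          field_simp
          norm_num
  have hcc : ∀ k, ‖(cramerCoeff a k : ℂ)‖ ≤ ‖b k‖ := by
    intro k
    rw [hcb, Complex.norm_real]
    exact Complex.abs_re_le_norm _
  have hgs := hasSum_geometric_two.mul_left (M / (r / 4) ^ 3)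
  refine ⟨fun t ht => ⟨Summable.of_norm_bounded hgs.summable (hgeo _ hcc t ht),
    tsum_of_norm_bounded hgs (hgeo _ hcc t ht)⟩, fun t ht => ?_⟩
  have htn : ‖(t : ℂ)‖ < r / 8 := by simpa using ht
  have htm : (t : ℂ) ∈ Metric.ball (0 : ℂ) (r / 2) := by
    rw [mem_ball_zero_iff]; linarith
  have hwt := hw t htm
  have hconj : deriv (complexSeries a) ((starRingEnd ℂ) (w t)) = t := by
    rw [deriv_complexSeries_conj, hwt.2, Complex.conj_ofReal]
  have hreal : ((w t).re : ℂ) = w t := by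
    refine Complex.conj_eq_iff_re.1 ?_
    have := h.norm_sub_le_deriv (z := (starRingEnd ℂ) (w t)) (w := w t)
      (by rw [RCLike.norm_conj]; exact hwt.1.le) hwt.1.le
    rw [hconj, hwt.2, sub_self, norm_zero, mul_zero] at this
    exact sub_eq_zero.1 (norm_le_zero_iff.1 this)
  set u := (w t).re with hu
  -- This forces `u` to have the sign of `t`.
  have hnear : |t - u| ≤ 1 / 4 * |u| := by
    have := h.norm_deriv_sub_le hwt.1.le (w := 0) (by simpa using hr0.le)
    rw [hwt.2, h.deriv_zero, sub_zero, sub_zero, ← hreal, ← Complex.ofReal_sub, Complex.norm_real,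
      Complex.norm_real] at this
    exact this
  have hul : |u| ≤ r := by
    have := hwt.1.le
    rwa [← hreal, Complex.norm_real] at this
  refine ⟨u, hul, fun h0 => ?_, fun h0 => ?_, ?_, ?_⟩
  · by_contra! hneg
    rw [abs_of_neg hneg] at hnear
    linarith [le_abs_self (t - u)]
  · by_contra! hpos
    rw [abs_of_pos hpos] at hnear
    linarith [neg_abs_le (t - u)]
  · rw [hreal, hwt.2]
  · have hs := Complex.hasSum_taylorSeries_on_ball hΛd htm
    -- The Taylor coefficients of orders `0`, `1`, `2` vanish, so a factor `t³` splits off.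
    have hs3 := (hasSum_nat_add_iff' 3).2 hs
    simp only [Finset.sum_range_succ, Finset.sum_range_zero, iteratedDeriv_zero, hΛ0, hΛ1, hΛ2,
      smul_zero, add_zero, sub_zero] at hs3
    have hre := Complex.hasSum_re hs3
    have hval : (Λ t).re = t ^ 2 / 2 + (complexSeries a u).re - t * u := by
      rw [hΛ, legendreDefect, ← hreal, Complex.sub_re, Complex.add_re, ← Complex.ofReal_mul,
        Complex.ofReal_re, ← Complex.ofReal_pow, ← Complex.ofReal_ofNat, ← Complex.ofReal_div,
        Complex.ofReal_re]
    rw [hval] at hre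
    rw [← hre.tsum_eq, seriesValue, ← tsum_mul_left]
    congr 1
    ext k
    rw [hcb, smul_eq_mul, smul_eq_mul, ← Complex.ofReal_pow,
      show (((k + 3).factorial : ℂ))⁻¹ * (((t ^ (k + 3) : ℝ) : ℂ) * iteratedDeriv (k + 3) Λ 0) =
        ((t ^ (k + 3) : ℝ) : ℂ) * b k by simp only [hb]; ring, Complex.re_ofReal_mul]
    ring

/-! ### Exponential tilting -/

/-- The law `μ` has an exponential moment generating function `exp (T ^ 2 * g z)` on the unit
disc. -/
structure HasScaledCGF (μ : Measure ℝ) (T : ℝ) (g : ℂ → ℂ) : Prop where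
  integrable : ∀ z : ℂ, ‖z‖ < 1 → Integrable (fun y : ℝ => Complex.exp (z * y)) μ
  integral_eq : ∀ z : ℂ, ‖z‖ < 1 → ∫ y : ℝ, Complex.exp (z * y) ∂μ = Complex.exp (T ^ 2 * g z)

/-- The law of the normalized variable under the exponentially tilted measure. -/
def tiltedLaw (μ : Measure ℝ) (u m σ : ℝ) : Measure ℝ :=
  (μ.tilted fun y => u * y).map fun y => (y - m) / σ

theorem measurable_sub_div (m σ : ℝ) : Measurable fun y : ℝ => (y - m) / σ := by fun_prop

theorem HasScaledCGF.integrable_exp {μ : Measure ℝ} {T : ℝ} {g : ℂ → ℂ} (hμ : HasScaledCGF μ T g)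
    {u : ℝ} (hu : |u| < 1) : Integrable (fun y => Real.exp (u * y)) μ := by
  refine (hμ.integrable u (by simpa using hu)).re.congr (ae_of_all _ fun y => ?_)
  simp only [RCLike.re_to_complex]
  rw [← Complex.ofReal_mul, Complex.exp_ofReal_re]

theorem HasScaledCGF.integral_exp {μ : Measure ℝ} {T : ℝ} {a : ℕ → ℝ}
    (hμ : HasScaledCGF μ T (complexSeries a)) {u : ℝ} (hu : |u| < 1) :
    ∫ y, Real.exp (u * y) ∂μ = Real.exp (T ^ 2 * (complexSeries a u).re) := by
  have h := hμ.integral_eq u (by simpa using hu)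
  have h1 : ∀ y : ℝ, Complex.exp (u * y) = (Real.exp (u * y) : ℂ) := fun y => by push_cast; rfl
  have h2 : complexSeries a u = ((complexSeries a u).re : ℂ) :=
    Complex.ext (by simp) (by simp [complexSeries_ofReal_im])
  simp_rw [h1] at h
  rw [integral_complex_ofReal, h2] at h
  exact_mod_cast h

theorem HasScaledCGF.isProbabilityMeasure_tiltedLaw {μ : Measure ℝ} [IsProbabilityMeasure μ]
    {T : ℝ} {g : ℂ → ℂ} (hμ : HasScaledCGF μ T g) {u : ℝ} (hu : |u| < 1) (m σ : ℝ) :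
    IsProbabilityMeasure (tiltedLaw μ u m σ) := by
  have := isProbabilityMeasure_tilted (hμ.integrable_exp hu)
  exact Measure.isProbabilityMeasure_map (measurable_sub_div m σ).aemeasurable

/-- The characteristic function of the normalized tilted law. -/
theorem HasScaledCGF.charFun_tiltedLaw {μ : Measure ℝ} {T : ℝ} {a : ℕ → ℝ}
    (hμ : HasScaledCGF μ T (complexSeries a)) {u : ℝ} (m σ τ : ℝ) (hu : |u| + |τ / σ| < 1) :
    charFun (tiltedLaw μ u m σ) τ =
      Complex.exp (T ^ 2 * (complexSeries a (u + (τ / σ : ℝ) * Complex.I) - complexSeries a u) -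
        (τ / σ : ℝ) * Complex.I * m) := by
  have hu1 : |u| < 1 := by linarith [abs_nonneg (τ / σ)]
  have hz : ‖(u : ℂ) + (τ / σ : ℝ) * Complex.I‖ < 1 := by
    refine (norm_add_le _ _).trans_lt ?_
    rw [norm_mul, Complex.norm_I, mul_one, Complex.norm_real, Complex.norm_real]
    exact hu
  have h2 : complexSeries a u = ((complexSeries a u).re : ℂ) :=
    Complex.ext (by simp) (by simp [complexSeries_ofReal_im])
  rw [charFun_apply_real, tiltedLaw, integral_map (measurable_sub_div m σ).aemeasurable
    (Continuous.aestronglyMeasurable (by fun_prop)), integral_tilted, hμ.integral_exp hu1]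
  have h3 : ∀ y : ℝ, (Real.exp (u * y) / Real.exp (T ^ 2 * (complexSeries a u).re)) •
      Complex.exp (τ * ((y - m) / σ : ℝ) * Complex.I) =
      Complex.exp (-(T ^ 2 * complexSeries a u) - (τ / σ : ℝ) * Complex.I * m) *
      Complex.exp ((u + (τ / σ : ℝ) * Complex.I) * y) := by
    intro y
    rw [h2, ← Real.exp_sub, Complex.real_smul, Complex.ofReal_exp, ← Complex.exp_add,
      ← Complex.exp_add, Complex.ofReal_re]
    push_cast
    congr 1
    ring
  simp_rw [h3]
  rw [integral_const_mul, hμ.integral_eq _ hz, ← Complex.exp_add]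
  congr 1
  ring

/-- Probabilities as exponential integrals with respect to the normalized tilted law. -/
theorem HasScaledCGF.measureReal_eq {μ : Measure ℝ} [IsProbabilityMeasure μ] {T : ℝ} {a : ℕ → ℝ}
    (hμ : HasScaledCGF μ T (complexSeries a)) {u : ℝ} (hu : |u| < 1) (m : ℝ) {σ : ℝ} (hσ : 0 < σ)
    {I : Set ℝ} (hI : MeasurableSet I) :
    μ.real ((fun y => (y - m) / σ) ⁻¹' I) = Real.exp (T ^ 2 * (complexSeries a u).re - u * m) *
      ∫ z in I, Real.exp (-(u * σ * z)) ∂(tiltedLaw μ u m σ) := by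
  have hpre := measurable_sub_div m σ hI
  rw [tiltedLaw, setIntegral_map hI (Continuous.aestronglyMeasurable (by fun_prop))
    (measurable_sub_div m σ).aemeasurable, setIntegral_tilted' _ _ hpre, hμ.integral_exp hu]
  -- The tilting density cancels the integrand up to a constant.
  have h3 : ∀ y : ℝ, (Real.exp (u * y) / Real.exp (T ^ 2 * (complexSeries a u).re)) •
      Real.exp (-(u * σ * ((y - m) / σ))) =
      Real.exp (-(T ^ 2 * (complexSeries a u).re - u * m)) := by
    intro y
    rw [← Real.exp_sub, smul_eq_mul, ← Real.exp_add]
    congr 1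
    field_simp
    ring
  simp_rw [h3]
  rw [setIntegral_const, smul_eq_mul, mul_comm, mul_assoc, ← Real.exp_add, neg_add_cancel,
    Real.exp_zero, mul_one]

theorem charFun_std (τ : ℝ) :
    charFun (gaussianReal 0 1) τ = Complex.exp (-(τ : ℂ) ^ 2 / 2) := by
  rw [charFun_gaussianReal]
  congr 1
  simp
  ring

theorem norm_cexp_neg_sq (τ : ℝ) : ‖Complex.exp (-(τ : ℂ) ^ 2 / 2)‖ = Real.exp (-τ ^ 2 / 2) := by
  rw [Complex.norm_exp]
  congr 1
  have : (-(τ : ℂ) ^ 2 / 2) = ((-τ ^ 2 / 2 : ℝ) : ℂ) := by push_cast; rfl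
  rw [this, Complex.ofReal_re]

/-- The scale of the tilted law is `T √(g''(u))`. The constant bound keeps it away from `0`; the
linear one measures its distance from `T`. -/
theorem NormalizedCoeffs.variance_bounds {A : ℝ} {a : ℕ → ℝ} (h : NormalizedCoeffs A a) {u : ℝ}
    (hu : |u| ≤ saddleRadius A) :
    deriv (deriv (complexSeries a)) u = ((deriv (deriv (complexSeries a)) u).re : ℂ) ∧
    |(deriv (deriv (complexSeries a)) u).re - 1| ≤ 1536 * A * |u| ∧
    |(deriv (deriv (complexSeries a)) u).re - 1| ≤ 1 / 4 := by
  have hr := saddleRadius_le h.pos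
  have h1 : deriv (deriv (complexSeries a)) u = ((deriv (deriv (complexSeries a)) u).re : ℂ) :=
    Complex.ext (by simp) (by simp [h.deriv_deriv_ofReal_im (u := u) (by linarith)])
  have h2 := h.taylor_two (w := 0) (z := u) (by simp)
    (by rw [Complex.norm_real, Real.norm_eq_abs]; linarith)
  rw [h.deriv_deriv_zero, sub_zero, h1, ← Complex.ofReal_one, ← Complex.ofReal_sub,
    Complex.norm_real, Complex.norm_real, Real.norm_eq_abs, Real.norm_eq_abs] at h2
  refine ⟨h1, h2, h2.trans ?_⟩
  have h3 := mul_saddleRadius_le h.pos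
  have h4 := mul_le_mul_of_nonneg_left hu (by linarith [h.pos] : 0 ≤ 1536 * A)
  linarith

theorem three_fourths_le_sqrt {v : ℝ} (hv : |v - 1| ≤ 1 / 4) : 3 / 4 ≤ √v := by
  apply Real.le_sqrt_of_sq_le
  have := (abs_le.1 hv).1
  norm_num
  linarith

/-- The normalized tilted law is close to the normal law in Kolmogorov distance. -/
theorem exists_kolmogorov_tiltedLaw {A : ℝ} (hA : 0 < A) : ∃ C : ℝ, 0 ≤ C ∧
    ∀ (a : ℕ → ℝ) (μ : Measure ℝ) [IsProbabilityMeasure μ] (T u : ℝ), NormalizedCoeffs A a →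
    HasScaledCGF μ T (complexSeries a) → 0 < T → |u| ≤ saddleRadius A →
    ∀ J : Set ℝ, J.OrdConnected →
      |(tiltedLaw μ u (T ^ 2 * (deriv (complexSeries a) u).re)
        (T * √(deriv (deriv (complexSeries a)) u).re)).real J - (gaussianReal 0 1).real J| ≤
        C / T := by
  obtain ⟨C₀, hC₀, hsm⟩ := exists_smoothing_const
  set M := 1536 * A with hM
  have hM0 : 0 < M := by positivity
  -- With `s ≥ 3/4`, the bound `3/16` gives `|τ / (T s)| ≤ 1/4`, so the Taylor estimate applies at
  -- `u + iτ/(T s)`. The bound `1 / (12 M)` makes the cubic remainder at most `τ²/4`.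
  set δ := min (3 / 16) (1 / (12 * M)) with hδ
  have hδ0 : 0 < δ := by positivity
  refine ⟨C₀ * (1 / δ + 24 * M), by positivity, fun a μ _ T u h hμ hT hu J hJ => ?_⟩
  have hr := saddleRadius_le hA
  obtain ⟨hv1, hv2, hv3⟩ := NormalizedCoeffs.variance_bounds h hu
  set v := (deriv (deriv (complexSeries a)) u).re with hv
  have hs := three_fourths_le_sqrt hv3
  have hvs : √v ^ 2 = v := Real.sq_sqrt (by linarith [(abs_le.1 hv3).1])
  set s := √v with hsdef
  set t := (deriv (complexSeries a) u).re with ht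
  have ht1 : deriv (complexSeries a) u = (t : ℂ) :=
    Complex.ext (by simp [ht]) (by simp [h.deriv_ofReal_im (u := u) (by linarith)])
  have hs0 : 0 < s := by linarith
  have := hμ.isProbabilityMeasure_tiltedLaw (u := u) (by linarith) (T ^ 2 * t) (T * s)
  -- Centring removes the linear term of the exponent and scaling makes the quadratic term `-τ²/2`,
  -- so `R` is `T²` times the Taylor remainder of `g` at `u`.
  have key : ∀ τ : ℝ, |τ| ≤ δ * T → ∃ R : ℂ, ‖R‖ ≤ 3 * M / T * |τ| ^ 3 ∧ ‖R‖ ≤ τ ^ 2 / 4 ∧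
      charFun (tiltedLaw μ u (T ^ 2 * t) (T * s)) τ =
        Complex.exp (-(τ : ℂ) ^ 2 / 2) * Complex.exp R := by
    intro τ hτ
    set η := τ / (T * s) with hη
    have hη1 : |η| * (T * s) = |τ| := by
      rw [hη, abs_div, abs_of_pos (mul_pos hT hs0), div_mul_cancel₀ _ (by positivity)]
    have hη2 : |η| ≤ 1 / 4 := by
      rw [hη, abs_div, abs_of_pos (mul_pos hT hs0), div_le_iff₀ (by positivity)]
      have : δ ≤ 3 / 16 := min_le_left _ _
      nlinarith
    have hT3 := h.taylor_zero (w := u) (z := u + (η : ℂ) * Complex.I)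
      (by rw [Complex.norm_real, Real.norm_eq_abs]; linarith)
      (by
        refine (norm_add_le _ _).trans ?_
        rw [norm_mul, Complex.norm_I, mul_one, Complex.norm_real, Complex.norm_real,
          Real.norm_eq_abs, Real.norm_eq_abs]
        linarith)
    rw [add_sub_cancel_left, norm_mul, Complex.norm_I, mul_one, Complex.norm_real,
      Real.norm_eq_abs, ht1, hv1] at hT3
    set R := complexSeries a (u + η * Complex.I) - complexSeries a u - t * (η * Complex.I) -
      v * (η * Complex.I) ^ 2 / 2 with hR
    have hb1 : ‖(T : ℂ) ^ 2 * R‖ ≤ 3 * M / T * |τ| ^ 3 := by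
      rw [norm_mul, norm_pow, Complex.norm_real, Real.norm_of_nonneg hT.le]
      calc T ^ 2 * ‖R‖ ≤ T ^ 2 * (M * |η| ^ 3) := by gcongr
        _ = M / T * (|η| * (T * 1)) ^ 3 := by field_simp
        _ ≤ M / T * (|η| * (T * (s * (4 / 3)))) ^ 3 := by gcongr; linarith
        _ = (4 / 3) ^ 3 * M / T * (|η| * (T * s)) ^ 3 := by ring
        _ = (4 / 3) ^ 3 * M / T * |τ| ^ 3 := by rw [hη1]
        _ ≤ 3 * M / T * |τ| ^ 3 := by gcongr; norm_num
    refine ⟨(T : ℂ) ^ 2 * R, hb1, hb1.trans ?_, ?_⟩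
    · have h12 : δ * (12 * M) ≤ 1 := by
        have : δ ≤ 1 / (12 * M) := min_le_right _ _
        rwa [le_div_iff₀ (by positivity)] at this
      calc 3 * M / T * |τ| ^ 3 = 3 * M / T * |τ| * τ ^ 2 := by rw [← sq_abs τ]; ring
        _ ≤ 3 * M / T * (δ * T) * τ ^ 2 := by gcongr
        _ = (δ * (12 * M)) * (τ ^ 2 / 4) := by field_simp; ring
        _ ≤ 1 * (τ ^ 2 / 4) := by gcongr
        _ = τ ^ 2 / 4 := one_mul _
    · rw [hμ.charFun_tiltedLaw _ _ _ (by linarith), ← Complex.exp_add]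
      congr 1
      have e1 : (T : ℂ) ^ 2 * (v * (η * Complex.I) ^ 2 / 2) = -(τ : ℂ) ^ 2 / 2 := by
        have : (τ : ℂ) = η * (T * s) := by
          rw [hη]; push_cast
          rw [div_mul_cancel₀]
          exact mul_ne_zero (by exact_mod_cast hT.ne') (by exact_mod_cast hs0.ne')
        rw [this, mul_pow (η : ℂ) Complex.I, Complex.I_sq, ← hvs]
        push_cast
        ring
      rw [← e1, hR, ← hη, Complex.ofReal_mul, Complex.ofReal_pow]
      ring
  refine (hsm _ (gaussianReal 0 1) (δ * T) (24 * M / T) (by positivity) (by positivity)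
    (fun τ hτ => ?_) (fun τ hτ => ?_) (fun τ hτ => ?_) J hJ).trans_eq ?_
  · obtain ⟨R, hR1, hR2, hR3⟩ := key τ hτ
    rw [hR3, norm_mul, norm_cexp_neg_sq]
    calc _ ≤ Real.exp (-τ ^ 2 / 2) * Real.exp ‖R‖ := by
          gcongr
          rw [Complex.norm_exp]
          exact Real.exp_le_exp.2 (Complex.re_le_norm R)
      _ ≤ _ := by
          rw [← Real.exp_add, Real.exp_le_exp]
          linarith
  · rw [charFun_std, norm_cexp_neg_sq, Real.exp_le_exp]
    nlinarith [sq_nonneg τ]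
  · obtain ⟨R, hR1, hR2, hR3⟩ := key τ hτ
    rw [hR3, charFun_std, ← mul_sub_one, norm_mul, norm_cexp_neg_sq]
    -- Of `|τ|³ e^{-τ²/4}`, one factor `|τ|` and half of the exponent are kept for the smoothing
    -- inequality; the rest is at most `8`, whence `κ = 8 · 3M/T`.
    have h8 : τ ^ 2 * Real.exp (-τ ^ 2 / 8) ≤ 8 := by
      have h1 := Real.add_one_le_exp (τ ^ 2 / 8)
      have h2 : Real.exp (-τ ^ 2 / 8) * Real.exp (τ ^ 2 / 8) = 1 := by
        rw [← Real.exp_add, neg_div, neg_add_cancel, Real.exp_zero]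
      nlinarith [Real.exp_pos (-τ ^ 2 / 8)]
    have hexp : ‖Complex.exp R - 1‖ ≤ ‖R‖ * Real.exp ‖R‖ := by
      simpa using Complex.norm_exp_sub_sum_le_norm_mul_exp R 1
    calc _ ≤ Real.exp (-τ ^ 2 / 2) * (‖R‖ * Real.exp ‖R‖) := by gcongr
      _ = ‖R‖ * (Real.exp (-τ ^ 2 / 2) * Real.exp ‖R‖) := by ring
      _ ≤ (3 * M / T * |τ| ^ 3) * (Real.exp (-τ ^ 2 / 8) * Real.exp (-τ ^ 2 / 8)) := by
          rw [← Real.exp_add, ← Real.exp_add]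
          refine mul_le_mul hR1 (Real.exp_le_exp.2 ?_) (Real.exp_pos _).le (by positivity)
          linarith
      _ = 3 * M / T * |τ| * (τ ^ 2 * Real.exp (-τ ^ 2 / 8)) * Real.exp (-τ ^ 2 / 8) := by
          rw [← sq_abs τ]; ring
      _ ≤ 3 * M / T * |τ| * 8 * Real.exp (-τ ^ 2 / 8) := by gcongr
      _ = _ := by ring
  · field_simp

/-- The tail of `μ` at a saddle point, relative to the normal tail. -/
theorem exists_tail_ratio {A : ℝ} (hA : 0 < A) : ∃ C : ℝ, 0 ≤ C ∧
    ∀ (a : ℕ → ℝ) (μ : Measure ℝ) [IsProbabilityMeasure μ] (T u t : ℝ), NormalizedCoeffs A a →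
    HasScaledCGF μ T (complexSeries a) → 0 < T → 0 ≤ u → u ≤ saddleRadius A →
    deriv (complexSeries a) u = t →
    ∀ I : Set ℝ, I = Set.Ici (T ^ 2 * t) ∨ I = Set.Ioi (T ^ 2 * t) →
      ∃ r : ℝ, |r| ≤ C * ((T * t + 1) / T) ∧ μ.real I / (1 - stdNormalDF (T * t)) =
        Real.exp (T ^ 2 * (t ^ 2 / 2 + (complexSeries a u).re - t * u)) * (1 + r) := by
  obtain ⟨C, hC, hK⟩ := exists_kolmogorov_tiltedLaw hA
  obtain ⟨c, hc, hL⟩ := exists_le_gaussianLaplace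
  set M := 1536 * A with hM
  have hM0 : 0 < M := by positivity
  refine ⟨(C + 4 * M) / c, by positivity, fun a μ _ T u t h hμ hT hu0 hu ht I hI => ?_⟩
  have hua : |u| ≤ saddleRadius A := by rwa [abs_of_nonneg hu0]
  have hr := saddleRadius_le hA
  obtain ⟨hv1, hv2, hv3⟩ := NormalizedCoeffs.variance_bounds h hua
  have hKu := hK a μ T u h hμ hT hua
  set v := (deriv (deriv (complexSeries a)) u).re with hv
  have hs := three_fourths_le_sqrt hv3
  have hvs : √v ^ 2 = v := Real.sq_sqrt (by linarith [(abs_le.1 hv3).1])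
  set s := √v with hsdef
  have hs0 : 0 < s := by linarith
  have hσ : 0 < T * s := by positivity
  rw [ht, Complex.ofReal_re] at hKu
  have hprob := hμ.isProbabilityMeasure_tiltedLaw (u := u) (by linarith) (T ^ 2 * t) (T * s)
  -- the saddle point is close to the argument
  have htu : |t - u| ≤ M * u ^ 2 := by
    have := h.taylor_one (w := 0) (z := u) (by simp)
      (by rw [Complex.norm_real, Real.norm_eq_abs]; linarith)
    rw [ht, h.deriv_zero, h.deriv_deriv_zero, sub_zero, sub_zero, one_mul, ← Complex.ofReal_sub,
      Complex.norm_real, Complex.norm_real, Real.norm_eq_abs, Real.norm_eq_abs, sq_abs] at this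
    exact this
  have hMu : M * u ≤ 1 / 4 :=
    (mul_le_mul_of_nonneg_left hu hM0.le).trans (mul_saddleRadius_le hA)
  have htu' : 3 / 4 * u ≤ t := by
    have := (abs_le.1 htu).1
    nlinarith
  have ht0 : 0 ≤ t := by linarith
  -- From `|s - 1| (s + 1) = |s² - 1| = |v - 1|` and `s + 1 ≥ 1`.
  have hsu : |s - 1| ≤ M * u := by
    have h1 : |s - 1| * |s + 1| = |v - 1| := by
      rw [← abs_mul, ← hvs]; congr 1; ring
    rw [abs_of_nonneg hu0] at hv2
    rw [abs_of_pos (by linarith : 0 < s + 1)] at h1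
    nlinarith [abs_nonneg (s - 1)]
  -- Both arguments are at least `(3/4) T u` and they differ by at most `2 M T u²`. The powers of
  -- `u` cancel, which makes the error `O(1/T)` uniform down to `u = 0`.
  have hψ : |gaussianLaplace (u * (T * s)) - gaussianLaplace (T * t)| ≤ 4 * M / T := by
    rcases hu0.eq_or_lt with h0 | hupos
    · have : t = 0 := by
        rw [← h0] at htu
        simpa using htu
      rw [this, ← h0, zero_mul, mul_zero, sub_self, abs_zero]
      positivity
    · have hm : 0 < 3 / 4 * (T * u) := by positivity
      refine (abs_gaussianLaplace_sub_le hm (a := u * (T * s)) (x := T * t) ?_ ?_).trans ?_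
      · nlinarith [mul_pos hT hupos]
      · nlinarith
      · have h1 : |u * (T * s) - T * t| ≤ 2 * M * T * u ^ 2 := by
          rw [show u * (T * s) - T * t = T * (u * (s - 1) - (t - u)) by ring, abs_mul,
            abs_of_pos hT]
          have h2 := abs_sub (u * (s - 1)) (t - u)
          rw [abs_mul, abs_of_pos hupos] at h2
          have h3 : |u * (s - 1) - (t - u)| ≤ 2 * M * u ^ 2 := by
            nlinarith [mul_le_mul_of_nonneg_left hsu hu0]
          nlinarith
        rw [div_le_div_iff₀ (by positivity) hT]
        have h5 : 0 ≤ M * T ^ 2 * u ^ 2 := by positivity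
        nlinarith [mul_le_mul_of_nonneg_right h1 hT.le]
  -- the tail as an exponential integral of the tilted law
  obtain ⟨J, hJc, hJ0, hJ1, hIJ⟩ : ∃ J : Set ℝ, J.OrdConnected ∧ Set.Ioi 0 ⊆ J ∧ J ⊆ Set.Ici 0 ∧
      I = (fun y => (y - T ^ 2 * t) / (T * s)) ⁻¹' J := by
    rcases hI with hI | hI
    · refine ⟨Set.Ici 0, Set.ordConnected_Ici, Set.Ioi_subset_Ici_self, subset_rfl, ?_⟩
      ext y
      rw [hI, Set.mem_preimage, Set.mem_Ici, Set.mem_Ici, le_div_iff₀ hσ, zero_mul, sub_nonneg]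
    · refine ⟨Set.Ioi 0, Set.ordConnected_Ioi, subset_rfl, Set.Ioi_subset_Ici_self, ?_⟩
      ext y
      rw [hI, Set.mem_preimage, Set.mem_Ioi, Set.mem_Ioi, lt_div_iff₀ hσ, zero_mul, sub_pos]
  have hE := abs_setIntegral_exp_sub_le hKu hJc hJ1 (a := u * (T * s)) (by positivity)
  rw [setIntegral_exp_gaussianReal hJ0 hJ1 hJc.measurableSet] at hE
  have hP := hμ.measureReal_eq (u := u) (by linarith) (T ^ 2 * t) hσ hJc.measurableSet
  rw [← hIJ] at hP
  set E := ∫ z in J, Real.exp (-(u * (T * s) * z)) ∂(tiltedLaw μ u (T ^ 2 * t) (T * s))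
  set ψ := gaussianLaplace (T * t) with hψdef
  have hx0 : 0 ≤ T * t := by positivity
  have hψ0 : c / (1 + T * t) ≤ ψ := hL _ hx0
  have hψpos : 0 < ψ := lt_of_lt_of_le (by positivity) hψ0
  -- The relative error of the tilted integral against the normal one.
  refine ⟨(E - ψ) / ψ, ?_, ?_⟩
  · have h1 : |E - ψ| ≤ (C + 4 * M) / T := by
      have := abs_sub_le E (gaussianLaplace (u * (T * s))) ψ
      rw [add_div]
      linarith
    rw [abs_div, abs_of_pos hψpos]
    calc |E - ψ| / ψ ≤ ((C + 4 * M) / T) / (c / (1 + T * t)) := by gcongr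
      _ = (C + 4 * M) / c * ((T * t + 1) / T) := by field_simp; ring
  · rw [hP, one_sub_stdNormalDF_eq, ← hψdef, div_eq_iff (by positivity)]
    have h1 : 1 + (E - ψ) / ψ = E / ψ := by field_simp; ring
    have h2 : Real.exp (T ^ 2 * (t ^ 2 / 2 + (complexSeries a u).re - t * u)) *
        Real.exp (-(T * t) ^ 2 / 2) =
        Real.exp (T ^ 2 * (complexSeries a u).re - u * (T ^ 2 * t)) := by
      rw [← Real.exp_add]; congr 1; ring
    rw [h1, ← h2]
    field_simp

/-- Reflection replaces `g(z)` by `g(-z)`, which reduces lower tails to upper tails. -/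
theorem HasScaledCGF.map_neg {μ : Measure ℝ} {T : ℝ} {a : ℕ → ℝ}
    (hμ : HasScaledCGF μ T (complexSeries a)) :
    HasScaledCGF (μ.map fun y => -y) T (complexSeries fun k => (-1) ^ k * a k) where
  integrable z hz := by
    rw [integrable_map_measure (Continuous.aestronglyMeasurable (by fun_prop))
      measurable_neg.aemeasurable]
    refine (hμ.integrable (-z) (by rwa [norm_neg])).congr (ae_of_all _ fun y => ?_)
    simp
  integral_eq z hz := by
    rw [integral_map measurable_neg.aemeasurable (Continuous.aestronglyMeasurable (by fun_prop)),
      complexSeries_alternating, ← hμ.integral_eq (-z) (by rwa [norm_neg])]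
    congr 1
    ext y
    simp

theorem deriv_complexSeries_alternating (a : ℕ → ℝ) (z : ℂ) :
    deriv (complexSeries fun k => (-1) ^ k * a k) z = -deriv (complexSeries a) (-z) := by
  rw [← deriv_comp_neg]
  congr 1
  ext z
  exact complexSeries_alternating a z

/-- Large deviations of a law with a scaled cumulant generating function. -/
theorem exists_largeDeviations {A : ℝ} (hA : 0 < A) : ∃ ρ > 0, ∃ K C : ℝ, 0 ≤ C ∧
    ∀ a, NormalizedCoeffs A a →
    (∀ t : ℂ, ‖t‖ < ρ → Summable (fun k => (cramerCoeff a k : ℂ) * t ^ k) ∧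
      ‖∑' k, (cramerCoeff a k : ℂ) * t ^ k‖ ≤ K) ∧
    ∀ (μ : Measure ℝ) [IsProbabilityMeasure μ] (T x : ℝ), HasScaledCGF μ T (complexSeries a) →
      0 < T → 0 ≤ x → x < ρ * T →
      (∃ r : ℝ, |r| ≤ C * ((x + 1) / T) ∧ μ.real (Set.Ici (x * T)) / (1 - stdNormalDF x) =
        Real.exp (x ^ 3 / T * seriesValue (cramerCoeff a) (x / T)) * (1 + r)) ∧
      (∃ r : ℝ, |r| ≤ C * ((x + 1) / T) ∧ μ.real (Set.Iio (-(x * T))) / stdNormalDF (-x) =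
        Real.exp (-(x ^ 3 / T) * seriesValue (cramerCoeff a) (-(x / T))) * (1 + r)) := by
  obtain ⟨ρ, hρ, K, hser⟩ := exists_cramerSeries hA
  obtain ⟨C, hC, htail⟩ := exists_tail_ratio hA
  refine ⟨ρ, hρ, K, C, hC, fun a h => ⟨(hser a h).1, fun μ _ T x hμ hT hx hxT => ⟨?_, ?_⟩⟩⟩
  · have hxt : T * (x / T) = x := by field_simp
    obtain ⟨u, hu, hu0, -, hut, hval⟩ := (hser a h).2 (x / T) (by
      rw [abs_of_nonneg (by positivity), div_lt_iff₀ hT]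
      exact hxT)
    obtain ⟨r, hr, hrat⟩ := htail a μ T u (x / T) h hμ hT (hu0 (by positivity))
      ((le_abs_self u).trans hu) hut _ (Or.inl rfl)
    rw [hxt] at hr hrat
    refine ⟨r, hr, ?_⟩
    rw [← hval, show T ^ 2 * (x / T) = x * T by field_simp] at hrat
    rw [hrat]
    congr 2
    field_simp
  · have hxt : T * (x / T) = x := by field_simp
    obtain ⟨u, hu, -, hu0, hut, hval⟩ := (hser a h).2 (-(x / T)) (by
      rw [abs_neg, abs_of_nonneg (by positivity), div_lt_iff₀ hT]
      exact hxT)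
    have hneg := Measure.isProbabilityMeasure_map (μ := μ) measurable_neg.aemeasurable
    -- If `u` solves the equation at `-x/T`, then `-u` solves the reflected one at `x/T`. The
    -- exponent is thus expressed by the series of `a` at `-x/T`, and the Cramér coefficients of the
    -- reflected law are not needed.
    obtain ⟨r, hr, hrat⟩ := htail _ (μ.map fun y => -y) T (-u) (x / T) h.alternating hμ.map_neg hT
      (neg_nonneg.2 (hu0 (neg_nonpos.2 (by positivity)))) ((neg_le_abs u).trans hu) (by
        rw [deriv_complexSeries_alternating, Complex.ofReal_neg, neg_neg, hut]
        push_cast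
        ring) _ (Or.inr rfl)
    rw [hxt] at hr hrat
    refine ⟨r, hr, ?_⟩
    rw [complexSeries_alternating, Complex.ofReal_neg, neg_neg,
      map_measureReal_apply measurable_neg measurableSet_Ioi] at hrat
    have hpre : (fun y : ℝ => -y) ⁻¹' Set.Ioi (T ^ 2 * (x / T)) = Set.Iio (-(x * T)) := by
      ext y
      rw [show T ^ 2 * (x / T) = x * T by field_simp, Set.mem_preimage, Set.mem_Ioi, Set.mem_Iio,
        lt_neg]
    rw [hpre] at hrat
    rw [stdNormalDF_neg, hrat]
    congr 2
    rw [show (x / T) ^ 2 / 2 + (complexSeries a u).re - x / T * -u =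
      (-(x / T)) ^ 2 / 2 + (complexSeries a u).re - -(x / T) * u by ring, ← hval]
    field_simp

/-! ### Cumulants and the complex cumulant generating function -/

/-- Agreement near a real point passes to the first derivatives, so induction works once `f` and `g`
are both allowed to vary. -/
theorem iteratedDeriv_eq_ofReal {g : ℝ → ℝ} (k : ℕ) : ∀ {f : ℂ → ℂ} {u : ℝ},
    AnalyticAt ℂ f u → (∀ᶠ x : ℝ in 𝓝 u, f x = g x) →
    iteratedDeriv k f u = ((iteratedDeriv k g u : ℝ) : ℂ) := by
  induction k generalizing g with
  | zero =>
    intro f u _ h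
    simpa using h.self_of_nhds
  | succ k ih =>
    intro f u hf h
    rw [iteratedDeriv_succ', iteratedDeriv_succ']
    refine ih hf.deriv ?_
    have hcont : Tendsto (fun x : ℝ => (x : ℂ)) (𝓝 u) (𝓝 u) :=
      Complex.continuous_ofReal.tendsto u
    filter_upwards [h.eventually_nhds, hcont.eventually hf.eventually_analyticAt] with x hx hfx
    have hd := hfx.differentiableAt.hasDerivAt
    have h1 : HasDerivAt g (deriv f x).re x :=
      hd.real_of_complex.congr_of_eventuallyEq (hx.mono fun y hy => by
        simp only [hy, Complex.ofReal_re])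
    have h2 : HasDerivAt (fun y : ℝ => f y) ((deriv f x).re : ℂ) x :=
      h1.ofReal_comp.congr_of_eventuallyEq hx
    rw [h1.deriv]
    exact hd.comp_ofReal.unique h2

section CGF
variable {Ω : Type*} [MeasurableSpace Ω] {P : Measure Ω} {X : Ω → ℝ} {H : ℝ} {L : ℂ → ℂ}

theorem IsCGFOnDisc.integrable_exp (h : IsCGFOnDisc P X H L) {u : ℝ} (hu : |u| < H) :
    Integrable (fun ω => Real.exp (u * X ω)) P := by
  refine (h.integrable_cexp u (by simpa using hu)).re.congr (ae_of_all _ fun y => ?_)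
  simp only [RCLike.re_to_complex]
  rw [← Complex.ofReal_mul, Complex.exp_ofReal_re]

/-- Taking norms in the defining equation avoids the question whether `L` is real on the real axis.
-/
theorem IsCGFOnDisc.mgf_eq (h : IsCGFOnDisc P X H L) {u : ℝ}
    (hu : |u| < H) : mgf X P u = Real.exp (L u).re := by
  have h1 := h.exp_eq u (by simpa using hu)
  rw [complexMGF_ofReal] at h1
  have h2 := congrArg norm h1
  rw [Complex.norm_exp, Complex.norm_real, Real.norm_of_nonneg mgf_nonneg] at h2
  exact h2.symm

theorem zero_mem_interior_integrableExpSet (hH : 0 < H)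
    (h : ∀ u : ℝ, |u| < H → Integrable (fun ω => Real.exp (u * X ω)) P) :
    0 ∈ interior (integrableExpSet X P) := by
  rw [mem_interior]
  refine ⟨Set.Ioo (-H) H, fun u hu => h u (abs_lt.2 hu), isOpen_Ioo, ⟨by linarith, hH⟩⟩

/-- The derivatives at `0` of the complex cumulant generating function are the cumulants. -/
theorem IsCGFOnDisc.iteratedDeriv_zero [IsProbabilityMeasure P] (hH : 0 < H)
    (h : IsCGFOnDisc P X H L) (k : ℕ) : iteratedDeriv k L 0 = (cumulant P X k : ℂ) := by
  have han : AnalyticAt ℂ L ((0 : ℝ) : ℂ) := by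
    rw [Complex.ofReal_zero]
    exact h.analytic 0 (Metric.mem_ball_self hH)
  have := iteratedDeriv_eq_ofReal (g := cgf X P) k han ?_
  · rw [cumulant, ← this, Complex.ofReal_zero]
  · have hcont : Tendsto (fun x : ℝ => (x : ℂ)) (𝓝 0) (𝓝 ((0 : ℝ) : ℂ)) :=
      Complex.continuous_ofReal.tendsto 0
    have hL : Tendsto (fun x : ℝ => (L x).im) (𝓝 0) (𝓝 0) := by
      have := (Complex.continuous_im.tendsto _).comp (han.continuousAt.tendsto.comp hcont)
      rw [Complex.ofReal_zero, h.map_zero, Complex.zero_im] at this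
      exact this
    have hpi := Real.pi_pos
    -- Near `0` the imaginary part of `L` lies in `(-π, π)`, so `L` is the principal logarithm there
    -- and equals `cgf`.
    filter_upwards [hL.eventually (Ioo_mem_nhds (neg_lt_zero.2 hpi) hpi),
      Metric.ball_mem_nhds (0 : ℝ) hH] with x hx hxH
    have he := h.exp_eq x (by simpa using hxH)
    rw [← Complex.log_exp hx.1 hx.2.le, he, complexMGF_ofReal, cgf, Complex.ofReal_log mgf_nonneg]

theorem IsCGFOnDisc.hasSum (hH : 0 < H) [IsProbabilityMeasure P] (h : IsCGFOnDisc P X H L)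
    {z : ℂ} (hz : ‖z‖ < H) :
    HasSum (fun k => ((cumulant P X k / k.factorial : ℝ) : ℂ) * z ^ k) (L z) := by
  have := Complex.hasSum_taylorSeries_on_ball h.analytic.differentiableOn
    (mem_ball_zero_iff.2 hz)
  refine this.congr_fun fun k => ?_
  rw [h.iteratedDeriv_zero hH, sub_zero, smul_eq_mul, smul_eq_mul]
  push_cast
  ring

/-- Cauchy's estimate on circles of radius `R < H`, followed by `R → H`, since the bound on `L`
holds on the open disc only. -/
theorem IsCGFOnDisc.abs_cumulant_le (hH : 0 < H) [IsProbabilityMeasure P]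
    (h : IsCGFOnDisc P X H L) {c : ℝ} (hc : ∀ z : ℂ, ‖z‖ < H → ‖L z‖ ≤ c) (k : ℕ) :
    |cumulant P X k / k.factorial| * H ^ k ≤ c := by
  have hev : ∀ᶠ R in 𝓝[<] H, |cumulant P X k / k.factorial| * R ^ k ≤ c := by
    filter_upwards [Ioo_mem_nhdsLT hH] with R hR
    have h1 := Complex.norm_iteratedDeriv_le_of_forall_mem_sphere_norm_le (c := 0) (R := R)
      (C := c) (f := L) k hR.1
      (DifferentiableOn.diffContOnCl_ball h.analytic.differentiableOn
        (Metric.closedBall_subset_ball hR.2))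
      fun z hz => hc z (by rw [mem_sphere_zero_iff_norm.1 hz]; exact hR.2)
    rw [h.iteratedDeriv_zero hH, Complex.norm_real, Real.norm_eq_abs,
      le_div_iff₀ (pow_pos hR.1 k)] at h1
    have hk : (0 : ℝ) < k.factorial := by exact_mod_cast k.factorial_pos
    rw [abs_div, abs_of_pos hk, div_mul_eq_mul_div, div_le_iff₀ hk]
    linarith
  refine le_of_tendsto ?_ hev
  exact ((continuous_const.mul (continuous_pow k)).tendsto H).mono_left nhdsWithin_le_nhds

theorem cumulant_zero [IsProbabilityMeasure P] : cumulant P X 0 = 0 := by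
  simp [cumulant, cgf_zero]

theorem IsCGFOnDisc.cumulant_one (hH : 0 < H) [IsProbabilityMeasure P] (h : IsCGFOnDisc P X H L) :
    cumulant P X 1 = ∫ ω, X ω ∂P := by
  rw [cumulant, iteratedDeriv_one,
    deriv_cgf_zero (zero_mem_interior_integrableExpSet hH fun u hu => h.integrable_exp hu),
    probReal_univ, div_one]

theorem IsCGFOnDisc.cumulant_two (hH : 0 < H) [IsProbabilityMeasure P] (h : IsCGFOnDisc P X H L) :
    cumulant P X 2 = variance X P := by
  rw [cumulant, ← variance_tilted_mul
    (zero_mem_interior_integrableExpSet hH fun u hu => h.integrable_exp hu)]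
  simp

end CGF

/-! ### The moment generating function of the infinite sum -/

theorem tendsto_latticeCube (d : ℕ) : Tendsto (latticeCube d) atTop atTop := by
  refine tendsto_atTop_finset_of_monotone (fun m n hmn => ?_) fun j => ?_
  · have : (m : ℤ) ≤ n := by exact_mod_cast hmn
    exact Finset.Icc_subset_Icc (fun _ => by simpa using this) fun _ => this
  · obtain ⟨m, hm⟩ := (Set.finite_range fun i => (j i).natAbs).bddAbove
    refine ⟨m, Finset.mem_Icc.2 ⟨fun i => ?_, fun i => ?_⟩⟩ <;>
    · have : (j i).natAbs ≤ m := hm ⟨i, rfl⟩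
      simp only
      omega

section Sum
variable {Ω : Type*} [MeasurableSpace Ω] {P : Measure Ω} {ι : Type*}
  {X : ι → Ω → ℝ} {S : Ω → ℝ} {H : ℝ} {L : ι → ℂ → ℂ} {c : ι → ℝ} {s : ℕ → Finset ι}

/-- Fatou's lemma along an almost surely convergent subsequence: by independence the exponential
moments of all partial sums are at most `exp (∑ c_j)`. -/
theorem integrable_exp_mul_of_tendstoInMeasure [IsProbabilityMeasure P]
    (hX : ∀ j, Measurable (X j)) (hi : iIndepFun X P)
    (hL : ∀ j, IsCGFOnDisc P (X j) H (L j))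
    (hS : TendstoInMeasure P (fun m ω => ∑ j ∈ s m, X j ω) atTop S)
    (hc : ∀ j, ∀ z : ℂ, ‖z‖ < H → ‖L j z‖ ≤ c j) (hcs : Summable c) {u : ℝ} (hu : |u| < H) :
    Integrable (fun ω => Real.exp (u * S ω)) P := by
  have hSm : AEMeasurable S P := hS.aemeasurable fun m =>
    (Finset.measurable_fun_sum _ fun j _ => hX j).aemeasurable
  obtain ⟨ns, -, hns⟩ := hS.exists_seq_tendsto_ae
  have hun : ‖(u : ℂ)‖ < H := by simpa using hu
  have hc0 : ∀ j, 0 ≤ c j := fun j => (norm_nonneg _).trans (hc j u hun)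
  refine ⟨(hSm.const_mul u).exp.aestronglyMeasurable, ?_⟩
  rw [hasFiniteIntegral_iff_ofReal (ae_of_all _ fun ω => (Real.exp_pos _).le)]
  have hb : ∀ m, ∫⁻ ω, ENNReal.ofReal (Real.exp (u * ∑ j ∈ s m, X j ω)) ∂P ≤
      ENNReal.ofReal (Real.exp (∑' j, c j)) := by
    intro m
    have hint := hi.integrable_exp_mul_sum hX (t := u) (s := s m)
      fun j _ => (hL j).integrable_exp hu
    have hmgf := hi.mgf_sum hX (t := u) (s m)
    simp only [mgf, Finset.sum_apply] at hint hmgf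
    rw [← ofReal_integral_eq_lintegral_ofReal hint (ae_of_all _ fun ω => (Real.exp_pos _).le), hmgf]
    refine ENNReal.ofReal_le_ofReal ?_
    calc ∏ j ∈ s m, ∫ ω, Real.exp (u * X j ω) ∂P = ∏ j ∈ s m, Real.exp (L j u).re :=
          Finset.prod_congr rfl fun j _ => (hL j).mgf_eq hu
      _ = Real.exp (∑ j ∈ s m, (L j u).re) := (Real.exp_sum _ _).symm
      _ ≤ Real.exp (∑' j, c j) := by
          refine Real.exp_le_exp.2 (le_trans (Finset.sum_le_sum fun j _ => ?_)
            (hcs.sum_le_tsum _ fun j _ => hc0 j))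
          exact (Complex.re_le_norm _).trans (hc j u hun)
  refine lt_of_le_of_lt ?_ (ENNReal.ofReal_lt_top (r := Real.exp (∑' j, c j)))
  calc ∫⁻ ω, ENNReal.ofReal (Real.exp (u * S ω)) ∂P
      = ∫⁻ ω, liminf (fun k => ENNReal.ofReal (Real.exp (u * ∑ j ∈ s (ns k), X j ω))) atTop ∂P := by
        refine lintegral_congr_ae (hns.mono fun ω hω => ?_)
        have hcont : Continuous fun y : ℝ => ENNReal.ofReal (Real.exp (u * y)) :=
          ENNReal.continuous_ofReal.comp (by fun_prop)
        exact ((hcont.tendsto (S ω)).comp hω).liminf_eq.symm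
    _ ≤ liminf (fun k => ∫⁻ ω, ENNReal.ofReal (Real.exp (u * ∑ j ∈ s (ns k), X j ω)) ∂P) atTop :=
        lintegral_liminf_le fun k => by
          have := Finset.measurable_fun_sum (s (ns k)) fun j _ => hX j
          fun_prop
    _ ≤ ENNReal.ofReal (Real.exp (∑' j, c j)) :=
        liminf_le_of_frequently_le' (Frequently.of_forall fun k => hb (ns k))

theorem charFun_sum_eq_exp (hX : ∀ j, Measurable (X j)) (hi : iIndepFun X P)
    (hL : ∀ j, IsCGFOnDisc P (X j) H (L j)) (s : Finset ι) {τ : ℝ} (hτ : |τ| < H) :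
    ∫ ω, Complex.exp ((τ * ∑ j ∈ s, X j ω : ℝ) * Complex.I) ∂P =
      Complex.exp (∑ j ∈ s, L j (τ * Complex.I)) := by
  have hn : ‖(τ : ℂ) * Complex.I‖ < H := by simpa using hτ
  have h1 : ∀ ω, Complex.exp ((τ * ∑ j ∈ s, X j ω : ℝ) * Complex.I) =
      ∏ j ∈ s, Complex.exp (τ * Complex.I * X j ω) := by
    intro ω
    rw [← Complex.exp_sum, ← Finset.mul_sum]
    push_cast
    congr 1
    ring
  simp_rw [h1]
  rw [Complex.exp_sum]
  have h2 : ∀ j, Complex.exp (L j (τ * Complex.I)) =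
      ∫ ω, Complex.exp (τ * Complex.I * X j ω) ∂P := fun j => (hL j).exp_eq _ hn
  simp_rw [h2]
  have hi' : iIndepFun (fun (j : s) ω => Complex.exp (τ * Complex.I * X j ω)) P := by
    have := (hi.precomp (g := ((↑) : s → ι)) Subtype.val_injective).comp
      (fun _ x => Complex.exp (τ * Complex.I * (x : ℝ))) fun _ => by fun_prop
    exact this
  have := hi'.integral_fun_prod_eq_prod_integral fun j =>
    (by have := hX j; fun_prop :
      Measurable fun ω => Complex.exp (τ * Complex.I * X j ω)).aestronglyMeasurable
  rw [← Finset.prod_coe_sort s fun j => ∫ ω, Complex.exp (τ * Complex.I * X j ω) ∂P, ← this]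
  congr 1
  ext ω
  exact (Finset.prod_coe_sort s fun j => Complex.exp (τ * Complex.I * X j ω)).symm

/-- The moment generating function of a sum in probability of independent variables. -/
theorem complexMGF_eq_exp_tsum [IsProbabilityMeasure P] (hX : ∀ j, Measurable (X j))
    (hi : iIndepFun X P) (hH : 0 < H)
    (hL : ∀ j, IsCGFOnDisc P (X j) H (L j)) (hs : Tendsto s atTop atTop)
    (hS : TendstoInMeasure P (fun m ω => ∑ j ∈ s m, X j ω) atTop S)
    (hc : ∀ j, ∀ z : ℂ, ‖z‖ < H → ‖L j z‖ ≤ c j) (hcs : Summable c) {z : ℂ} (hz : ‖z‖ < H) :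
    complexMGF S P z = Complex.exp (∑' j, L j z) := by
  have hSi : ∀ u : ℝ, |u| < H → Integrable (fun ω => Real.exp (u * S ω)) P := fun u hu =>
    integrable_exp_mul_of_tendstoInMeasure hX hi hL hS hc hcs hu
  have hSm : AEMeasurable S P := hS.aemeasurable fun m =>
    (Finset.measurable_fun_sum _ fun j _ => hX j).aemeasurable
  have h1 : AnalyticOnNhd ℂ (complexMGF S P) (Metric.ball 0 H) := by
    refine analyticOnNhd_complexMGF.mono fun z hz => ?_
    have hz' : |z.re| < H := (Complex.abs_re_le_norm z).trans_lt (mem_ball_zero_iff.1 hz)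
    rw [Set.mem_ofPred_eq, mem_interior]
    exact ⟨Set.Ioo (-H) H, fun u hu => hSi u (abs_lt.2 hu), isOpen_Ioo, abs_lt.1 hz'⟩
  have h2 : AnalyticOnNhd ℂ (fun z => Complex.exp (∑' j, L j z)) (Metric.ball 0 H) := by
    refine DifferentiableOn.analyticOnNhd (DifferentiableOn.cexp ?_) Metric.isOpen_ball
    exact Complex.differentiableOn_tsum_of_summable_norm hcs
      (fun j => (hL j).analytic.differentiableOn) Metric.isOpen_ball
      fun j z hz => hc j z (mem_ball_zero_iff.1 hz)
  -- On the imaginary axis the exponentials have modulus `1`, so dominated convergence applies to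
  -- the partial sums.
  have h3 : ∀ τ : ℝ, |τ| < H →
      complexMGF S P (τ * Complex.I) = Complex.exp (∑' j, L j (τ * Complex.I)) := by
    intro τ hτ
    have hn : ‖(τ : ℂ) * Complex.I‖ < H := by simpa using hτ
    obtain ⟨ns, hmono, hns⟩ := hS.exists_seq_tendsto_ae
    have hlim1 : Tendsto
        (fun k => ∫ ω, Complex.exp ((τ * ∑ j ∈ s (ns k), X j ω : ℝ) * Complex.I) ∂P) atTop
        (𝓝 (∫ ω, Complex.exp ((τ * S ω : ℝ) * Complex.I) ∂P)) := by
      refine tendsto_integral_of_dominated_convergence (fun _ => 1) (fun k => ?_)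
        (integrable_const _) (fun k => ae_of_all _ fun ω => ?_) (hns.mono fun ω hω => ?_)
      · have := Finset.measurable_fun_sum (s (ns k)) fun j _ => hX j
        exact (by fun_prop : Measurable _).aestronglyMeasurable
      · rw [Complex.norm_exp_ofReal_mul_I]
      · have hcont : Continuous fun y : ℝ => Complex.exp ((τ * y : ℝ) * Complex.I) := by fun_prop
        exact (hcont.tendsto (S ω)).comp hω
    have hsum : Summable fun j => L j (τ * Complex.I) :=
      Summable.of_norm_bounded hcs fun j => hc j _ hn
    have hlim2 : Tendsto (fun k => Complex.exp (∑ j ∈ s (ns k), L j (τ * Complex.I))) atTop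
        (𝓝 (Complex.exp (∑' j, L j (τ * Complex.I)))) :=
      (Complex.continuous_exp.tendsto _).comp
        (hsum.hasSum.comp (hs.comp hmono.tendsto_atTop))
    simp_rw [charFun_sum_eq_exp hX hi hL _ hτ] at hlim1
    rw [← tendsto_nhds_unique hlim1 hlim2, complexMGF]
    congr 1
    ext ω
    push_cast
    congr 1
    ring
  -- The identity theorem: both sides are analytic and agree at the points `iH/(n+2)`, which
  -- accumulate at `0`.
  refine h1.eqOn_of_preconnected_of_frequently_eq h2 (convex_ball _ _).isPreconnected
    (Metric.mem_ball_self hH) ?_ (mem_ball_zero_iff.2 hz)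
  have ht : Tendsto (fun n : ℕ => (((H / (n + 2) : ℝ) : ℂ) * Complex.I)) atTop (𝓝[≠] 0) := by
    refine tendsto_nhdsWithin_iff.2 ⟨?_, Eventually.of_forall fun n => ?_⟩
    · have h4 : Tendsto (fun n : ℕ => H / ((n : ℝ) + 2)) atTop (𝓝 0) :=
        Tendsto.const_div_atTop (tendsto_atTop_add_const_right _ _ tendsto_natCast_atTop_atTop) H
      have := ((Complex.continuous_ofReal.tendsto 0).comp h4).mul_const Complex.I
      simpa using this
    · refine mul_ne_zero ?_ Complex.I_ne_zero
      rw [Complex.ofReal_ne_zero]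
      positivity
  refine ht.frequently (Frequently.of_forall fun n => h3 _ ?_)
  rw [abs_of_pos (by positivity), div_lt_iff₀ (by positivity)]
  nlinarith [(Nat.cast_nonneg n : (0 : ℝ) ≤ n)]

end Sum

/-! ### Normalized cumulants of a row -/

/-- The cumulants `γ` of a family of random variables, summed and normalized: the Taylor
coefficients of `z ↦ (∑ j, L j (h z)) / (B h ^ 2)`, where `B` is the sum of the variances. -/
def normalizedCumulants {ι : Type*} (h : ℝ) (γ : ι → ℕ → ℝ) (k : ℕ) : ℝ :=
  (∑' j, γ j k) / k.factorial * h ^ k / ((∑' j, γ j 2) * h ^ 2)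

open Classical in
/-- The coefficients of the Cramér series, as functions of the radius and of the cumulants. -/
def cramerCoeffOfCumulants {ι : Type*} (h : ℝ) (γ : ι → ℕ → ℝ) (k : ℕ) : ℝ :=
  if ∑' j, γ j 2 = 0 then 0 else cramerCoeff (normalizedCumulants h γ) k

section Row
variable {Ω : Type*} [MeasurableSpace Ω] {P : Measure Ω} [IsProbabilityMeasure P] {ι : Type*}
  {X : ι → Ω → ℝ} {S : Ω → ℝ} {H : ℝ} {L : ι → ℂ → ℂ} {c : ι → ℝ}

theorem tsum_cumulant_two (hH : 0 < H) (hL : ∀ j, IsCGFOnDisc P (X j) H (L j)) :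
    ∑' j, cumulant P (X j) 2 = varSum P X :=
  tsum_congr fun j => (hL j).cumulant_two hH

/-- The factor `H^k` is the one in Cauchy's estimate, so each coefficient is at most `∑ c_j / (B
H²)`. Orders `1` and `2` are fixed by centring and by the normalization with the variance. -/
theorem normalizedCoeffs_normalizedCumulants (hX0 : ∀ j, ∫ ω, X j ω ∂P = 0) (hH : 0 < H)
    (hL : ∀ j, IsCGFOnDisc P (X j) H (L j)) (hc : ∀ j, ∀ z : ℂ, ‖z‖ < H → ‖L j z‖ ≤ c j)
    (hcs : Summable c) (hB : 0 < varSum P X) {A : ℝ} (hA : ∑' j, c j ≤ A * (varSum P X * H ^ 2)) :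
    NormalizedCoeffs A (normalizedCumulants H fun j k => cumulant P (X j) k) where
  bound k := by
    rw [normalizedCumulants, tsum_cumulant_two hH hL, abs_div,
      abs_of_pos (by positivity : 0 < varSum P X * H ^ 2), div_le_iff₀ (by positivity)]
    refine le_trans ?_ hA
    rw [← tsum_div_const, ← tsum_mul_right]
    rw [← Real.norm_eq_abs]
    refine tsum_of_norm_bounded hcs.hasSum fun j => ?_
    rw [norm_mul, Real.norm_eq_abs, Real.norm_of_nonneg (by positivity : 0 ≤ H ^ k)]
    exact (hL j).abs_cumulant_le hH (hc j) k
  zero := by simp [normalizedCumulants, cumulant_zero]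
  one := by
    have : ∀ j, cumulant P (X j) 1 = 0 := fun j => by rw [(hL j).cumulant_one hH, hX0]
    simp [normalizedCumulants, this]
  two := by
    rw [normalizedCumulants, tsum_cumulant_two hH hL]
    simp only [Nat.factorial]
    field_simp
    norm_num

/-- The sums over `j` and over `k` may be exchanged because `c_j |z|^k` dominates the double series.
-/
theorem complexSeries_normalizedCumulants (hH : 0 < H)
    (hL : ∀ j, IsCGFOnDisc P (X j) H (L j)) (hc : ∀ j, ∀ z : ℂ, ‖z‖ < H → ‖L j z‖ ≤ c j)
    (hcs : Summable c) (hB : 0 < varSum P X) {z : ℂ} (hz : ‖z‖ < 1) :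
    ((varSum P X * H ^ 2 : ℝ) : ℂ) *
      complexSeries (normalizedCumulants H fun j k => cumulant P (X j) k) z =
      ∑' j, L j (H * z) := by
  have hHz : ‖(H : ℂ) * z‖ < H := by
    rw [norm_mul, Complex.norm_real, Real.norm_of_nonneg hH.le]
    nlinarith
  have hc0 : ∀ j, 0 ≤ c j := fun j => (norm_nonneg _).trans (hc j _ hHz)
  have hsum : Summable (Function.uncurry fun (j : ι) (k : ℕ) =>
      ((cumulant P (X j) k / k.factorial : ℝ) : ℂ) * ((H : ℂ) * z) ^ k) := by
    refine Summable.of_norm_bounded (hcs.mul_of_nonneg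
      (summable_geometric_of_lt_one (norm_nonneg z) hz) hc0 fun k => by positivity) fun p => ?_
    obtain ⟨j, k⟩ := p
    simp only [Function.uncurry]
    rw [mul_pow, ← mul_assoc, norm_mul, norm_mul, norm_pow, norm_pow, Complex.norm_real,
      Complex.norm_real, Real.norm_of_nonneg hH.le]
    exact mul_le_mul_of_nonneg_right ((hL j).abs_cumulant_le hH (hc j) k) (by positivity)
  have h1 : ∑' j, L j (H * z) = ∑' j, ∑' k,
      ((cumulant P (X j) k / k.factorial : ℝ) : ℂ) * ((H : ℂ) * z) ^ k :=
    tsum_congr fun j => ((hL j).hasSum hH hHz).tsum_eq.symm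
  rw [h1, ← hsum.tsum_comm, complexSeries, ← tsum_mul_left]
  refine tsum_congr fun k => ?_
  rw [tsum_mul_right, ← Complex.ofReal_tsum, tsum_div_const, mul_pow, ← mul_assoc, ← mul_assoc,
    ← Complex.ofReal_mul, ← Complex.ofReal_pow, ← Complex.ofReal_mul]
  congr 2
  rw [normalizedCumulants, tsum_cumulant_two hH hL]
  field_simp

/-- Multiplying the sum by `H` turns the disc `|z| < H` into the unit disc, and `T² = B H²`. -/
theorem hasScaledCGF_map {s : ℕ → Finset ι} (hX : ∀ j, Measurable (X j)) (hi : iIndepFun X P)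
    (hH : 0 < H) (hL : ∀ j, IsCGFOnDisc P (X j) H (L j)) (hs : Tendsto s atTop atTop)
    (hS : TendstoInMeasure P (fun m ω => ∑ j ∈ s m, X j ω) atTop S)
    (hc : ∀ j, ∀ z : ℂ, ‖z‖ < H → ‖L j z‖ ≤ c j) (hcs : Summable c) (hB : 0 < varSum P X) :
    HasScaledCGF (P.map fun ω => H * S ω) (H * √(varSum P X))
      (complexSeries (normalizedCumulants H fun j k => cumulant P (X j) k)) := by
  have hSm : AEMeasurable S P := hS.aemeasurable fun m =>
    (Finset.measurable_fun_sum _ fun j _ => hX j).aemeasurable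
  have hHz : ∀ z : ℂ, ‖z‖ < 1 → ‖(H : ℂ) * z‖ < H := fun z hz => by
    rw [norm_mul, Complex.norm_real, Real.norm_of_nonneg hH.le]
    nlinarith
  have hcexp : ∀ z : ℂ, Continuous fun y : ℝ => Complex.exp (z * y) := fun z => by fun_prop
  constructor
  · intro z hz
    rw [integrable_map_measure (hcexp z).aestronglyMeasurable (hSm.const_mul H)]
    have h1 := integrable_exp_mul_of_tendstoInMeasure hX hi hL hS hc hcs
      ((Complex.abs_re_le_norm _).trans_lt (hHz z hz))
    refine h1.mono' ((hcexp z).measurable.comp_aemeasurable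
      (hSm.const_mul H)).aestronglyMeasurable (ae_of_all _ fun ω => ?_)
    rw [Function.comp_apply, Complex.norm_exp]
    simp
    ring_nf
    rfl
  · intro z hz
    rw [integral_map (hSm.const_mul H) (hcexp z).aestronglyMeasurable]
    have h1 := complexMGF_eq_exp_tsum hX hi hH hL hs hS hc hcs (hHz z hz)
    rw [← complexSeries_normalizedCumulants hH hL hc hcs hB hz, complexMGF] at h1
    have h2 : ((H * √(varSum P X) : ℝ) : ℂ) ^ 2 = ((varSum P X * H ^ 2 : ℝ) : ℂ) := by
      rw [← Complex.ofReal_pow, mul_pow, Real.sq_sqrt hB.le, mul_comm]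
    rw [h2, ← h1]
    congr 1
    ext ω
    push_cast
    congr 1
    ring

end Row

/-! ### Uniformity in `n` and the main theorem -/

/-- The finitely many exceptional indices are absorbed into the constant, since the bound on `λ_n`
is claimed for every `n`. -/
theorem exists_forall_le_mul_of_isBigO {f g : ℕ → ℝ} (h : f =O[atTop] g) :
    ∃ A : ℝ, 0 < A ∧ ∀ n, 0 < g n → f n ≤ A * g n := by
  obtain ⟨C, hC⟩ := h.bound
  obtain ⟨N, hN⟩ := eventually_atTop.1 hC
  refine ⟨|C| + ∑ n ∈ Finset.range N, |f n / g n| + 1, by positivity, fun n hn => ?_⟩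
  have hs : 0 ≤ ∑ n ∈ Finset.range N, |f n / g n| := Finset.sum_nonneg fun _ _ => abs_nonneg _
  rcases le_or_gt N n with h1 | h1
  · have h2 := hN n h1
    rw [Real.norm_of_nonneg hn.le] at h2
    have h3 := le_abs_self (f n)
    have h4 := mul_le_mul_of_nonneg_right (le_abs_self C) hn.le
    rw [Real.norm_eq_abs] at h2
    nlinarith
  · rw [← div_le_iff₀ hn]
    have h2 := Finset.single_le_sum (f := fun n => |f n / g n|) (fun _ _ => abs_nonneg _)
      (Finset.mem_range.2 h1)
    linarith [le_abs_self (f n / g n), abs_nonneg C]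

theorem map_mul_measureReal {Ω : Type*} [MeasurableSpace Ω] {P : Measure Ω} {S : Ω → ℝ}
    (hS : AEMeasurable S P) (H : ℝ) {I : Set ℝ} (hI : MeasurableSet I) :
    (P.map fun ω => H * S ω).real I = P.real {ω | H * S ω ∈ I} := by
  rw [Measure.real, Measure.map_apply_of_aemeasurable (hS.const_mul H) hI]
  rfl

theorem normalizedDF_eq {Ω : Type*} [MeasurableSpace Ω] {P : Measure Ω} {S : Ω → ℝ}
    (hS : AEMeasurable S P) {H : ℝ} (hH : 0 < H) (B x : ℝ) :
    normalizedDF P S B x = (P.map fun ω => H * S ω).real (Set.Iio (x * (H * √B))) := by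
  rw [map_mul_measureReal hS H measurableSet_Iio, normalizedDF]
  congr 1
  ext ω
  simp only [Set.mem_ofPred_eq, Set.mem_Iio]
  rw [show x * (H * √B) = H * (x * √B) by ring, mul_lt_mul_iff_right₀ hH]

end

theorem theorem1 (d : ℕ) :
    -- `β h γ k`: the `k`-th coefficient, a function of the radius `h` and of the cumulants `γ`
    ∃ β : ℝ → ((Fin d → ℤ) → ℕ → ℝ) → ℕ → ℝ,
      ∀ (Ω : Type*) [MeasurableSpace Ω] (P : Measure Ω) [IsProbabilityMeasure P]
        (X : ℕ → (Fin d → ℤ) → Ω → ℝ) (S : ℕ → Ω → ℝ) (H : ℕ → ℝ)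
        (L : ℕ → (Fin d → ℤ) → ℂ → ℂ) (c : ℕ → (Fin d → ℤ) → ℝ) (B T : ℕ → ℝ)
        (b : ℕ → ℕ → ℝ),
        -- the random field: measurable, independent in each row, centered
        (∀ n j, Measurable (X n j)) →
        (∀ n, iIndepFun (X n) P) →
        (∀ n j, ∫ ω, X n j ω ∂P = 0) →
        -- analytic cumulant generating functions on the discs `|z| < H n`
        (∀ n, 0 < H n) →
        (∀ n j, IsCGFOnDisc P (X n j) (H n) (L n j)) →
        -- the row sums and their variances
        (∀ n, TendstoInMeasure P (fun (m : ℕ) ω => ∑ j ∈ latticeCube d m, X n j ω) atTop (S n)) →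
        (∀ n, Summable fun j => variance (X n j) P) →
        (∀ n, B n = varSum P (X n)) →
        -- the bounds on the cumulant generating functions
        (∀ n j, ∀ z : ℂ, ‖z‖ < H n → ‖L n j z‖ ≤ c n j) →
        Tendsto (fun n => B n * H n ^ 2) atTop atTop →
        (∀ n, Summable (c n)) →
        ((fun n => ∑' j, c n j) =O[atTop] fun n => B n * H n ^ 2) →
        -- abbreviations: `T n = H n √(B n)`, and `b n` is the coefficient sequence of `λ_n`
        (∀ n, T n = H n * √(B n)) →
        (∀ n, b n = β (H n) (fun j k => cumulant P (X n j) k)) →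
        -- `λ_n` converges and is bounded on a disc about `0`, uniformly in `n`
        (∃ ρ > 0, ∃ K : ℝ, ∀ n, ∀ t : ℂ, ‖t‖ < ρ →
          Summable (fun k => (b n k : ℂ) * t ^ k) ∧ ‖∑' k, (b n k : ℂ) * t ^ k‖ ≤ K) ∧
        -- the two expansions, uniformly on every range `0 ≤ x ≤ a n` with `a n = o(T n)`
        ∃ C : ℝ, ∀ a : ℕ → ℝ, a =o[atTop] T →
          ∀ᶠ n in atTop, ∀ x : ℝ, 0 ≤ x → x ≤ a n →
            (∃ r : ℝ, |r| ≤ C * ((x + 1) / T n) ∧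
              (1 - normalizedDF P (S n) (B n) x) / (1 - stdNormalDF x) =
                Real.exp (x ^ 3 / T n * seriesValue (b n) (x / T n)) * (1 + r)) ∧
            (∃ r : ℝ, |r| ≤ C * ((x + 1) / T n) ∧
              normalizedDF P (S n) (B n) (-x) / stdNormalDF (-x) =
                Real.exp (-(x ^ 3 / T n) * seriesValue (b n) (-(x / T n))) * (1 + r)) := by
  refine ⟨cramerCoeffOfCumulants, ?_⟩
  intro Ω _ P _ X S H L c B T b hX hi hX0 hH hL hS _ hB hc hBH hcs hO hT hb
  obtain ⟨A, hA, hAn⟩ := exists_forall_le_mul_of_isBigO hO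
  obtain ⟨ρ, hρ, K, C, hC, hmain⟩ := exists_largeDeviations hA
  have hcoeff : ∀ n, 0 < B n → NormalizedCoeffs A
      (normalizedCumulants (H n) fun j k => cumulant P (X n j) k) := by
    intro n hn
    have hHn := hH n
    have h1 := hAn n (by positivity)
    rw [hB n] at hn h1
    exact normalizedCoeffs_normalizedCumulants (hX0 n) hHn (hL n) (hc n) (hcs n) hn h1
  have hbeq : ∀ n, 0 < B n → b n =
      cramerCoeff (normalizedCumulants (H n) fun j k => cumulant P (X n j) k) := by
    intro n hn
    ext k
    rw [hb n, cramerCoeffOfCumulants, tsum_cumulant_two (hH n) (hL n), ← hB n, if_neg hn.ne']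
  -- The absolute value makes the bound valid also for the zero series.
  refine ⟨⟨ρ, hρ, |K|, fun n t ht => ?_⟩, C, fun a ha => ?_⟩
  · have hB0 : 0 ≤ B n := by
      rw [hB n]
      exact tsum_nonneg fun j => variance_nonneg _ _
    -- For `B n = 0` the coefficients are `0` by definition; this can happen for finitely many `n`
    -- only.
    rcases hB0.eq_or_lt with h0 | hpos
    · have hb0 : ∀ k, b n k = 0 := by
        intro k
        rw [hb n, cramerCoeffOfCumulants, tsum_cumulant_two (hH n) (hL n), ← hB n, if_pos h0.symm]
      simp [hb0, summable_zero]
    · rw [hbeq n hpos]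
      obtain ⟨h1, h2⟩ := (hmain _ (hcoeff n hpos)).1 t ht
      exact ⟨h1, h2.trans (le_abs_self K)⟩
  -- Eventually `B n > 0` and `a n ≤ (ρ/2) T n`, so `x / T n` stays inside the disc of radius `ρ`.
  · filter_upwards [hBH.eventually_gt_atTop 0, ha.bound (half_pos hρ)] with n hBn han x hx hxa
    have hHn := hH n
    have hpos : 0 < B n := pos_of_mul_pos_left hBn (by positivity)
    have hTpos : 0 < T n := by rw [hT n]; positivity
    have hxT : x < ρ * T n := by
      rw [Real.norm_of_nonneg hTpos.le] at han
      have := (le_abs_self (a n)).trans han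
      nlinarith [mul_pos hρ hTpos]
    have hSm : AEMeasurable (S n) P := (hS n).aemeasurable fun m =>
      (Finset.measurable_fun_sum _ fun j _ => hX n j).aemeasurable
    have hlaw : HasScaledCGF (P.map fun ω => H n * S n ω) (T n)
        (complexSeries (normalizedCumulants (H n) fun j k => cumulant P (X n j) k)) := by
      rw [hT n, hB n]
      exact hasScaledCGF_map (hX n) (hi n) hHn (hL n) (tendsto_latticeCube d) (hS n) (hc n) (hcs n)
        (by rwa [← hB n])
    have hprob := Measure.isProbabilityMeasure_map (μ := P) (hSm.const_mul (H n))
    obtain ⟨h1, h2⟩ := (hmain _ (hcoeff n hpos)).2 _ (T n) x hlaw hTpos hx hxT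
    rw [← hbeq n hpos] at h1 h2
    rw [normalizedDF_eq hSm hHn, normalizedDF_eq hSm hHn, ← hT n, neg_mul]
    refine ⟨?_, h2⟩
    rwa [← Set.compl_Iio, probReal_compl_eq_one_sub measurableSet_Iio] at h1
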